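/- Let $T$ be an automorphism of a standard Borel probability space $(X,\mathcal B,\mu)$ (an invertible, up to null sets, measure-preserving map). Assume that $T$ is totally ergodic, i.e. $T^m$ is ergodic for every $m\neq 0$, and that it has Asymptotical Orthogonal Powers (AOP): for all $f,g\in L^2(\mu)$ with $\int_X f\,d\mu=\int_X g\,d\mu=0$, \[ \lim_{\substack{r,s\to\infty\\ r,s \text{ different primes}}}\ \sup_{\kappa}\left|\int_{X\times X} f(x)g(x')\,d\kappa(x,x')\right|=0, \] where $\kappa$ runs over the ergodic joinings of $T^r$ and $T^s$, i.e. the probability measures on $X\times X$ with both marginals equal to $\mu$ that are invariant and ergodic under $T^r\times T^s$. Let $S$ be a uniquely ergodic continuous map of a compact metric space $Y$, let $\nu$ be the unique $S$-invariant Borel probability measure on $Y$, and assume that the measure-theoretic systems $(X,\mu,T)$ and $(Y,\nu,S)$ are isomorphic. Then for every multiplicative function $u:\{1,2,\dots\}\to\mathbb C$ (that is, $u(1)=1$ and $u(mn)=u(m)u(n)$ for coprime $m,n$) with $|u|\le 1$, every continuous $f:Y\to\mathbb C$ with $\int_Y f\,d\nu=0$ and every $y\in Y$, \[ \lim_{N\to\infty}\frac1N\sum_{1\le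 n\le N} f(S^n y)\,u(n)=0 . \] In particular, the assertion of Sarnak's conjecture holds for $S$: for every continuous $f:Y\to\mathbb C$ (of arbitrary mean) and every $y\in Y$, \[ \lim_{N\to\infty}\frac1N\sum_{1\le n\le N} f(S^n y)\,\mu_{\mathrm{Möb}}(n)=0, \] where $\mu_{\mathrm{Möb}}$ is the Möbius function. -/

import Mathlib

open MeasureTheory Filter Topology
open scoped ENNReal

/-- `φ` is an invertible measure-preserving map `(X, μ) → (Y, ν)` in the sense of ergodic theory,
i.e. up to null sets. -/
def IsInvertibleMod0 {X Y : Type*} [MeasurableSpace X] [MeasurableSpace Y]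
    (φ : X → Y) (μ : Measure X) (ν : Measure Y) : Prop :=
  MeasurePreserving φ μ ν ∧
    ∃ ψ : Y → X, MeasurePreserving ψ ν μ ∧ (∀ᵐ x ∂μ, ψ (φ x) = x) ∧ (∀ᵐ y ∂ν, φ (ψ y) = y)

/-- `T` is an automorphism of `(X, μ)` (invertibility is understood mod null sets). -/
def IsAutomorphism {X : Type*} [MeasurableSpace X] (T : X → X) (μ : Measure X) : Prop :=
  IsInvertibleMod0 T μ μ

/-- All nonzero powers of `T` are ergodic. (For an automorphism, `T ^ (-m)` is ergodic if and only
if `T ^ m` is, so positive powers suffice.) -/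
def IsTotallyErgodic {X : Type*} [MeasurableSpace X] (T : X → X) (μ : Measure X) : Prop :=
  ∀ m : ℕ, 0 < m → Ergodic T^[m] μ

/-- The measure-theoretic systems `(X, μ, T)` and `(Y, ν, S)` are isomorphic. -/
def AreIsomorphic {X Y : Type*} [MeasurableSpace X] [MeasurableSpace Y]
    (T : X → X) (μ : Measure X) (S : Y → Y) (ν : Measure Y) : Prop :=
  ∃ φ : X → Y, IsInvertibleMod0 φ μ ν ∧ ∀ᵐ x ∂μ, φ (T x) = S (φ x)

/-- The ergodic joinings of `(X, μ, T₁)` and `(X, μ, T₂)`: the measures on `X × X` with both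
marginals `μ` that are invariant and ergodic under `T₁ × T₂`. -/
def ergodicJoinings {X : Type*} [MeasurableSpace X] (T₁ T₂ : X → X) (μ : Measure X) :
    Set (Measure (X × X)) :=
  {κ | κ.map Prod.fst = μ ∧ κ.map Prod.snd = μ ∧ Ergodic (Prod.map T₁ T₂) κ}

/-- The pairs of different primes `(r, s)`, with `r, s → ∞`. -/
def differentPrimesAtTop : Filter (ℕ × ℕ) :=
  (atTop ×ˢ atTop) ⊓ 𝓟 {p : ℕ × ℕ | p.1.Prime ∧ p.2.Prime ∧ p.1 ≠ p.2}

/-- Asymptotical Orthogonal Powers. The supremum is taken in `[0, ∞]`. -/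
def HasAOP {X : Type*} [MeasurableSpace X] (T : X → X) (μ : Measure X) : Prop :=
  ∀ f g : X → ℂ, MemLp f 2 μ → MemLp g 2 μ → ∫ x, f x ∂μ = 0 → ∫ x, g x ∂μ = 0 →
    Tendsto
      (fun p : ℕ × ℕ => ⨆ κ ∈ ergodicJoinings T^[p.1] T^[p.2] μ,
        ‖∫ z : X × X, f z.1 * g z.2 ∂κ‖ₑ)
      differentPrimesAtTop (𝓝 0)

/-- `ν` is the unique `S`-invariant Borel probability measure. -/
def IsUniquelyErgodic {Y : Type*} [MeasurableSpace Y] (S : Y → Y) (ν : Measure Y) : Prop :=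
  IsProbabilityMeasure ν ∧ MeasurePreserving S ν ν ∧
    ∀ ν' : Measure Y, IsProbabilityMeasure ν' → MeasurePreserving S ν' ν' → ν' = ν

/-- The conclusion of Sarnak's conjecture for `S`: every sequence `f (S ^ n y)` with `f` continuous
is asymptotically orthogonal to the Möbius function. -/
def IsMoebiusDisjoint {Y : Type*} [TopologicalSpace Y] (S : Y → Y) : Prop :=
  ∀ (f : C(Y, ℂ)) (y : Y),
    Tendsto
      (fun N : ℕ => (1 / (N : ℂ)) *
        ∑ n ∈ Finset.Icc 1 N, f (S^[n] y) * ((ArithmeticFunction.moebius n : ℤ) : ℂ))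
      atTop (𝓝 0)

/-! By the Kátai–Bourgain–Sarnak–Ziegler criterion, a bounded sequence `F` is orthogonal to every
multiplicative `u` with `|u| ≤ 1` as soon as the correlations of `F (p * m)` and `F (q * m)` are
asymptotically small for all large distinct primes `p`, `q`. The reason is that most `n` have close
to `∑ 1 / p` prime divisors in a finite set `P` of primes (Turán–Kubilius). Hence `∑ F n * u n` is
governed by the bilinear sum over products `p * m`, where `u (p * m) = u p * u m` for most `m`.
Cauchy–Schwarz in `m` then removes `u` and leaves the correlations
(`tendsto_mean_mul_of_prime_correlations`).

For `F n = f (S^[n] y)` these correlations are Birkhoff sums of `f ⊗ conj f` under `S^[p] × S^[q]`,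
started at `(y, y)`. Limits of empirical measures are invariant, and among invariant measures the
largest integral is attained at an ergodic one, so it suffices to bound the integral against ergodic
measures. Since `S^[p]` and `S^[q]` are again uniquely ergodic (this uses total ergodicity), such a
measure has both marginals `ν`. It is therefore an ergodic joining, which the isomorphism carries to
one of `T^[p]` and `T^[q]`, where AOP applies (`eventually_norm_sum_prime_correlation_le`).

For `f` of arbitrary mean, the constant part requires that the Möbius function have mean zero. This
follows from a Tauberian theorem and the non-vanishing of `ζ` on `re s ≥ 1`. -/

/-! ### A Tauberian theorem for Dirichlet series with bounded coefficients -/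

/-- The mean `x⁻¹ ∑_{k ≤ x} a k` at `x = exp t`. -/
noncomputable def expMean (a : ℕ → ℂ) (t : ℝ) : ℂ :=
  (∑ k ∈ Finset.Icc 1 ⌊Real.exp t⌋₊, a k) * Real.exp (-t)

section Tauberian

variable {a : ℕ → ℂ}

theorem norm_sum_Icc_le (ha : ∀ n, ‖a n‖ ≤ 1) (N : ℕ) : ‖∑ k ∈ Finset.Icc 1 N, a k‖ ≤ N := by
  simpa using norm_sum_le_of_le (Finset.Icc 1 N) (fun k _ => ha k)

theorem norm_expMean_le_one (ha : ∀ n, ‖a n‖ ≤ 1) (t : ℝ) : ‖expMean a t‖ ≤ 1 := by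
  rw [expMean, norm_mul, Complex.norm_real, Real.norm_of_nonneg (Real.exp_pos _).le]
  calc _ ≤ Real.exp t * Real.exp (-t) := by
        gcongr
        exact (norm_sum_Icc_le ha _).trans (Nat.floor_le (Real.exp_pos _).le)
    _ = 1 := by rw [← Real.exp_add]; simp

theorem expMean_of_neg {t : ℝ} (ht : t < 0) : expMean a t = 0 := by
  have : ⌊Real.exp t⌋₊ = 0 := Nat.floor_eq_zero.2 (by simpa using ht)
  simp [expMean, this]

theorem measurable_expMean : Measurable (expMean a) := by
  unfold expMean
  refine Measurable.mul ?_ (by fun_prop)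
  exact (measurable_from_nat (f := fun n => ∑ k ∈ Finset.Icc 1 n, a k)).comp
    (Nat.measurable_floor.comp Real.measurable_exp)

theorem norm_sum_Icc_sub_sum_Icc_le (ha : ∀ n, ‖a n‖ ≤ 1) {m n : ℕ} (h : m ≤ n) :
    ‖∑ k ∈ Finset.Icc 1 n, a k - ∑ k ∈ Finset.Icc 1 m, a k‖ ≤ (n : ℝ) - m := by
  have hI : ∀ n, Finset.Icc 1 n = Finset.Ioc 0 n := fun n => by ext; simp; omega
  rw [hI, hI, ← Finset.sum_Ioc_consecutive _ (Nat.zero_le m) h, add_sub_cancel_left]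
  refine (norm_sum_le_of_le _ (fun k _ => ha k)).trans ?_
  simp [Nat.cast_sub h]

/-- Slow variation, the Tauberian condition. Both the new summands and the change of normalisation
contribute at most `1 - exp (-(u - t)) ≤ u - t`; rounding to integers adds `exp (-u)`. -/
theorem norm_expMean_sub_le_of_le (ha : ∀ n, ‖a n‖ ≤ 1) {t u : ℝ} (h : t ≤ u) :
    ‖expMean a u - expMean a t‖ ≤ 2 * (u - t) + Real.exp (-u) := by
  have hE : ∀ x : ℝ, Real.exp x * Real.exp (-x) = 1 := fun x => by rw [← Real.exp_add]; simp
  set A : ℂ := ∑ k ∈ Finset.Icc 1 ⌊Real.exp t⌋₊, a k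
  set B : ℂ := ∑ k ∈ Finset.Icc 1 ⌊Real.exp u⌋₊, a k
  have hfl : ⌊Real.exp t⌋₊ ≤ ⌊Real.exp u⌋₊ := Nat.floor_mono (Real.exp_le_exp.2 h)
  have h1 : ‖B - A‖ ≤ Real.exp u - Real.exp t + 1 := by
    refine (norm_sum_Icc_sub_sum_Icc_le ha hfl).trans ?_
    have := Nat.floor_le (Real.exp_pos u).le
    have := Nat.lt_floor_add_one (Real.exp t)
    linarith
  have h2 : ‖A‖ ≤ Real.exp t :=
    (norm_sum_Icc_le ha _).trans (Nat.floor_le (Real.exp_pos _).le)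
  have hdec : expMean a u - expMean a t =
      (B - A) * (Real.exp (-u) : ℝ) - A * ((Real.exp (-t) - Real.exp (-u) : ℝ)) := by
    simp only [expMean, A, B]; push_cast; ring
  have hmono : Real.exp (-u) ≤ Real.exp (-t) := Real.exp_le_exp.2 (by linarith)
  have h3 : Real.exp t * Real.exp (-u) = Real.exp (-(u - t)) := by
    rw [← Real.exp_add]; ring_nf
  have h4 : 1 - (u - t) ≤ Real.exp (-(u - t)) := by
    have := Real.add_one_le_exp (-(u - t)); linarith
  rw [hdec]
  refine (norm_sub_le _ _).trans ?_
  rw [norm_mul, norm_mul, Complex.norm_real, Complex.norm_real,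
    Real.norm_of_nonneg (Real.exp_pos _).le, Real.norm_of_nonneg (sub_nonneg.2 hmono)]
  have h5 : ‖B - A‖ * Real.exp (-u) ≤ (Real.exp u - Real.exp t + 1) * Real.exp (-u) := by gcongr
  have h6 : ‖A‖ * (Real.exp (-t) - Real.exp (-u)) ≤
      Real.exp t * (Real.exp (-t) - Real.exp (-u)) :=
    mul_le_mul_of_nonneg_right h2 (sub_nonneg.2 hmono)
  have := hE u
  have := hE t
  nlinarith

theorem norm_expMean_sub_le (ha : ∀ n, ‖a n‖ ≤ 1) (t u : ℝ) :
    ‖expMean a t - expMean a u‖ ≤ 2 * |u - t| + Real.exp (-t) := by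
  rcases le_total t u with h | h
  · rw [norm_sub_rev, abs_of_nonneg (by linarith)]
    exact (norm_expMean_sub_le_of_le ha h).trans (by gcongr)
  · rw [abs_of_nonpos (by linarith)]
    exact (norm_expMean_sub_le_of_le ha h).trans (by linarith)

theorem norm_expMean_mul_exp_le (ha : ∀ n, ‖a n‖ ≤ 1) (σ t : ℝ) :
    ‖expMean a t * Real.exp (-(σ * t))‖ ≤
      Set.indicator (Set.Ici 0) (fun t => Real.exp (-σ * t)) t := by
  rcases lt_or_ge t 0 with ht | ht
  · rw [expMean_of_neg ht]; simp [ht]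
  · rw [Set.indicator_of_mem (by exact ht), norm_mul, Complex.norm_real,
      Real.norm_of_nonneg (Real.exp_pos _).le, neg_mul]
    exact mul_le_of_le_one_left (Real.exp_pos _).le (norm_expMean_le_one ha t)

theorem norm_expMean_mul_exp_le_one (ha : ∀ n, ‖a n‖ ≤ 1) {σ : ℝ} (hσ : 0 ≤ σ) (t : ℝ) :
    ‖expMean a t * Real.exp (-(σ * t))‖ ≤ 1 := by
  refine (norm_expMean_mul_exp_le ha σ t).trans ?_
  refine Set.indicator_apply_le' (fun (ht : 0 ≤ t) => ?_) (fun _ => zero_le_one)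
  exact Real.exp_le_one_iff.2 (by nlinarith)

theorem integrable_expMean_mul_exp (ha : ∀ n, ‖a n‖ ≤ 1) {σ : ℝ} (hσ : 0 < σ) :
    Integrable (fun t => expMean a t * Real.exp (-(σ * t))) := by
  refine Integrable.mono' (g := Set.indicator (Set.Ici 0) (fun t => Real.exp (-σ * t))) ?_ ?_ ?_
  · rw [integrable_indicator_iff measurableSet_Ici, integrableOn_Ici_iff_integrableOn_Ioi]
    exact exp_neg_integrableOn_Ioi 0 hσ
  · exact (measurable_expMean.mul (by fun_prop)).aestronglyMeasurable
  · exact .of_forall (norm_expMean_mul_exp_le ha σ)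

/-- Abel summation followed by the substitution `x = exp t`: `L(s) / s` is the Laplace transform of
the means at `s - 1`. The integral may run over all of `ℝ` because the means vanish for `t < 0`. -/
theorem integral_expMean_mul_exp (ha : ∀ n, ‖a n‖ ≤ 1) {s : ℂ} (hs : 1 < s.re) :
    ∫ t : ℝ, expMean a t * Complex.exp (-((s - 1) * t)) = LSeries a s / s := by
  have hs0 : s ≠ 0 := by rintro rfl; norm_num at hs
  have hO : (fun n => ∑ k ∈ Finset.Icc 1 n, ‖a k‖) =O[atTop] fun n => (n : ℝ) ^ (1 : ℝ) := by
    refine Asymptotics.IsBigO.of_bound 1 (.of_forall fun n => ?_)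
    rw [Real.norm_of_nonneg (Finset.sum_nonneg fun _ _ => norm_nonneg _)]
    simpa using Finset.sum_le_sum (s := Finset.Icc 1 n) (fun k _ => ha k)
  rw [LSeries_eq_mul_integral' a zero_le_one hs hO, mul_div_cancel_left₀ _ hs0]
  have h1 : ∫ (t : ℝ) in Set.Ioi 1, (∑ k ∈ Finset.Icc 1 ⌊t⌋₊, a k) * (t : ℂ) ^ (-(s + 1)) =
      ∫ (t : ℝ) in Set.Ioi 0, (∑ k ∈ Finset.Icc 1 ⌊t⌋₊, a k) * (t : ℂ) ^ (-(s + 1)) := by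
    rw [← integral_Ici_eq_integral_Ioi]
    refine (setIntegral_eq_of_subset_of_forall_sdiff_eq_zero measurableSet_Ioi ?_ ?_).symm
    · exact Set.Ici_subset_Ioi.2 zero_lt_one
    · rintro x ⟨_, hx⟩
      rw [Set.mem_Ici, not_le] at hx
      simp [Nat.floor_eq_zero.2 hx]
  rw [h1, ← Real.range_exp, ← Set.image_univ,
    integral_image_eq_integral_abs_deriv_smul MeasurableSet.univ
      (fun x _ => (Real.hasDerivAt_exp x).hasDerivWithinAt) Real.exp_injective.injOn,
    setIntegral_univ]
  congr 1 with t
  rw [abs_of_pos (Real.exp_pos t), expMean, Complex.real_smul,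
    Complex.cpow_def_of_ne_zero (by exact_mod_cast (Real.exp_pos t).ne'),
    ← Complex.ofReal_log (Real.exp_pos t).le, Real.log_exp]
  push_cast
  rw [mul_assoc, ← Complex.exp_add, mul_left_comm, ← Complex.exp_add]
  congr 2
  ring

/-- Smoothed means of `a`, expressed through the boundary behaviour of its Dirichlet series. -/
theorem integral_fourier_mul_expMean (ha : ∀ n, ‖a n‖ ≤ 1) (φ : SchwartzMap ℝ ℂ)
    {σ c : ℝ} (hσ : 0 < σ) (hc : 0 < c) (τ : ℝ) :
    ∫ u : ℝ, FourierTransform.fourier φ u *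
        (expMean a (τ + u / c) * Real.exp (-(σ * (τ + u / c)))) =
      ∫ v : ℝ, φ v * (c * Complex.exp (2 * Real.pi * Complex.I * c * τ * v) *
        (LSeries a (1 + σ + 2 * Real.pi * Complex.I * c * v) /
          (1 + σ + 2 * Real.pi * Complex.I * c * v))) := by
  set g : ℝ → ℂ := fun u => expMean a (τ + u / c) * Real.exp (-(σ * (τ + u / c))) with hg
  have hgi : Integrable g := by
    have h1 := (integrable_expMean_mul_exp ha hσ).comp_add_left τ
    exact h1.comp_div hc.ne'
  -- The multiplication formula `∫ φ̂ g = ∫ φ ĝ`; the damping by `σ > 0` makes `g` integrable.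
  have key := VectorFourier.integral_fourierIntegral_smul_eq_flip (μ := volume) (ν := volume)
    (L := innerₗ ℝ) (e := Real.fourierChar) (f := φ) (g := g)
    Real.continuous_fourierChar (by simpa using! continuous_inner) φ.integrable hgi
  have hflip : (innerₗ ℝ : ℝ →ₗ[ℝ] ℝ →ₗ[ℝ] ℝ).flip = innerₗ ℝ := by
    ext; simp
  rw [hflip] at key
  calc _ = ∫ u : ℝ, FourierTransform.fourier (φ : ℝ → ℂ) u • g u := by
        rw [← SchwartzMap.fourier_coe]; rfl
    _ = ∫ v : ℝ, φ v • FourierTransform.fourier g v := key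
    _ = _ := ?_
  congr 1 with v
  rw [smul_eq_mul]
  congr 1
  have hs : 1 < (1 + σ + 2 * Real.pi * Complex.I * c * v : ℂ).re := by
    simpa using hσ
  rw [Real.fourier_real_eq_integral_exp_smul, ← integral_expMean_mul_exp ha hs]
  set F : ℝ → ℂ := fun x => Complex.exp (-(2 * Real.pi * Complex.I * c * (x - τ) * v)) *
    (expMean a x * Real.exp (-(σ * x)))
  calc _ = ∫ u : ℝ, F (τ + u / c) := by
        congr 1 with u
        simp only [F, g, smul_eq_mul]
        congr 2
        have : (c : ℂ) ≠ 0 := by exact_mod_cast hc.ne'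
        push_cast
        field_simp
        ring
    _ = c * ∫ x : ℝ, F x := by
        rw [Measure.integral_comp_div (fun u => F (τ + u)), integral_add_left_eq_self,
          abs_of_pos hc]
        rfl
    _ = _ := by
        rw [mul_assoc, ← integral_const_mul (Complex.exp _)]
        congr 2 with x
        simp only [F]
        push_cast
        rw [mul_left_comm, ← Complex.exp_add, mul_left_comm, ← Complex.exp_add]
        congr 2
        ring

variable {G : ℂ → ℂ}

/-- Let `σ → 0+`. The left side is dominated by `‖φ̂‖`; on the right only a compact piece of the
line `re s = 1` matters, since `φ` has compact support. -/
theorem integral_fourier_mul_expMean_boundary (ha : ∀ n, ‖a n‖ ≤ 1)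
    (hG : ContinuousOn G {s | 1 ≤ s.re}) (hGa : ∀ s : ℂ, 1 < s.re → LSeries a s / s = G s)
    (φ : SchwartzMap ℝ ℂ) (hφ : HasCompactSupport φ) {c : ℝ} (hc : 0 < c) (τ : ℝ) :
    ∫ u : ℝ, FourierTransform.fourier φ u * expMean a (τ + u / c) =
      ∫ v : ℝ, φ v * (c * Complex.exp (2 * Real.pi * Complex.I * c * τ * v) *
        G (1 + 2 * Real.pi * Complex.I * c * v)) := by
  set ψ : ℝ → ℝ → ℂ := fun σ v => φ v * (c * Complex.exp (2 * Real.pi * Complex.I * c * τ * v) *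
        G (1 + σ + 2 * Real.pi * Complex.I * c * v)) with hψ
  have hcont : ContinuousOn (fun σ => ∫ v, ψ σ v) (Set.Ici 0) := by
    refine continuousOn_integral_of_compact_support (k := tsupport φ) hφ ?_ ?_
    · have h1 : ContinuousOn (fun p : ℝ × ℝ => G (1 + p.1 + 2 * Real.pi * Complex.I * c * p.2))
          (Set.Ici 0 ×ˢ Set.univ) := by
        refine hG.comp (by fun_prop) ?_
        rintro ⟨σ, v⟩ ⟨hσ, -⟩
        simpa using hσ
      have h2 : Continuous φ := φ.continuous
      refine ContinuousOn.mul (by fun_prop) (ContinuousOn.mul (by fun_prop) h1)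
    · intro σ v _ hv
      simp [hψ, image_eq_zero_of_notMem_tsupport hv]
  have hlim : Tendsto (fun σ => ∫ v, ψ σ v) (𝓝[>] 0) (𝓝 (∫ v, ψ 0 v)) :=
    (hcont 0 Set.self_mem_Ici).mono_left (nhdsWithin_mono _ Set.Ioi_subset_Ici_self)
  have hlim' : Tendsto (fun σ : ℝ => ∫ u : ℝ, FourierTransform.fourier φ u *
        (expMean a (τ + u / c) * Real.exp (-(σ * (τ + u / c))))) (𝓝[>] 0)
      (𝓝 (∫ u : ℝ, FourierTransform.fourier φ u * expMean a (τ + u / c))) := by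
    refine tendsto_integral_filter_of_dominated_convergence
      (fun u => ‖FourierTransform.fourier φ u‖) ?_ ?_ ?_ ?_
    · refine .of_forall fun σ => ?_
      refine (SchwartzMap.continuous _).aestronglyMeasurable.mul ?_
      exact ((measurable_expMean.comp (by fun_prop)).mul (by fun_prop)).aestronglyMeasurable
    · filter_upwards [self_mem_nhdsWithin] with σ hσ
      refine .of_forall fun u => ?_
      rw [norm_mul]
      exact mul_le_of_le_one_right (norm_nonneg _) (norm_expMean_mul_exp_le_one ha (le_of_lt hσ) _)
    · exact (SchwartzMap.integrable _).norm
    · refine .of_forall fun u => ?_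
      have : Continuous fun σ : ℝ => FourierTransform.fourier φ u *
        (expMean a (τ + u / c) * Real.exp (-(σ * (τ + u / c)))) := by fun_prop
      simpa using (this.tendsto 0).mono_left nhdsWithin_le_nhds
  refine (tendsto_nhds_unique (hlim.congr' ?_) hlim').symm.trans (by simp [hψ])
  filter_upwards [self_mem_nhdsWithin] with σ hσ
  rw [integral_fourier_mul_expMean ha φ hσ hc]
  congr 1 with v
  rw [hGa _ (by simpa using! hσ)]

/-- On the boundary line the smoothed mean is a Fourier transform at frequency `-c * τ`, so the
Riemann–Lebesgue lemma applies. -/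
theorem tendsto_integral_fourier_mul_expMean (ha : ∀ n, ‖a n‖ ≤ 1)
    (hG : ContinuousOn G {s | 1 ≤ s.re}) (hGa : ∀ s : ℂ, 1 < s.re → LSeries a s / s = G s)
    (φ : SchwartzMap ℝ ℂ) (hφ : HasCompactSupport φ) {c : ℝ} (hc : 0 < c) :
    Tendsto (fun τ => ∫ u : ℝ, FourierTransform.fourier φ u * expMean a (τ + u / c))
      atTop (𝓝 0) := by
  have h := (Real.tendsto_integral_exp_smul_cocompact
    (fun v : ℝ => φ v * (c * G (1 + 2 * Real.pi * Complex.I * c * v)))).comp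
    ((tendsto_neg_atTop_atBot.comp (tendsto_id.const_mul_atTop hc)).mono_right
      atBot_le_cocompact)
  refine h.congr fun τ => ?_
  rw [integral_fourier_mul_expMean_boundary ha hG hGa φ hφ hc, Function.comp_apply]
  refine integral_congr_ae (.of_forall fun v => ?_)
  simp only [Function.comp, Circle.smul_def, Real.fourierChar_apply, smul_eq_mul, id]
  rw [show ((2 * Real.pi * -(v * -(c * τ)) : ℝ) : ℂ) * Complex.I =
    2 * Real.pi * Complex.I * c * τ * v by push_cast; ring]
  ring

/-- Take a bump function equal to `1` at `0`: by Fourier inversion its transform has integral `φ 0 =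
1`. -/
theorem exists_schwartz_hasCompactSupport_integral_fourier :
    ∃ φ : SchwartzMap ℝ ℂ, HasCompactSupport φ ∧ ∫ u, FourierTransform.fourier φ u = 1 := by
  let b : ContDiffBump (0 : ℝ) := ⟨1, 2, one_pos, one_lt_two⟩
  have hb : HasCompactSupport (fun x => ((b x : ℝ) : ℂ)) :=
    b.hasCompactSupport.comp_left Complex.ofReal_zero
  have hb' : ContDiff ℝ (⊤ : ℕ∞) (fun x => ((b x : ℝ) : ℂ)) :=
    Complex.ofRealCLM.contDiff.comp b.contDiff
  refine ⟨hb.toSchwartzMap hb', hb, ?_⟩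
  set φ := hb.toSchwartzMap hb'
  have h1 := congrFun (φ.continuous.fourierInv_fourier_eq φ.integrable
    (by rw [← SchwartzMap.fourier_coe]; exact SchwartzMap.integrable _)) 0
  rw [← SchwartzMap.fourier_coe, Real.fourierInv_eq] at h1
  have h2 : φ 0 = 1 := by
    change ((b 0 : ℝ) : ℂ) = 1
    rw [b.one_of_mem_closedBall (by simp [b])]
    simp
  simpa [h2] using h1

/-- A sequence bounded by `1` has mean value zero if its Dirichlet series extends continuously to
the line `re s = 1`. -/
theorem tendsto_expMean_atTop (ha : ∀ n, ‖a n‖ ≤ 1)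
    (hG : ContinuousOn G {s | 1 ≤ s.re}) (hGa : ∀ s : ℂ, 1 < s.re → LSeries a s / s = G s) :
    Tendsto (expMean a) atTop (𝓝 0) := by
  obtain ⟨φ, hφ, hφ1⟩ := exists_schwartz_hasCompactSupport_integral_fourier
  set K := FourierTransform.fourier φ
  have hK : Integrable K := SchwartzMap.integrable _
  have hKn : Integrable (fun u => ‖u‖ * ‖K u‖) := by
    simpa using SchwartzMap.integrable_pow_mul volume K 1
  set A := ∫ u, ‖u‖ * ‖K u‖
  set B := ∫ u, ‖K u‖
  -- Smoothing at scale `1 / c` costs little by slow variation. The error `2 / c * A` does not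
  -- depend on `τ`, so `c` can be fixed before `τ → ∞`.
  have hbound : ∀ {c : ℝ}, 0 < c → ∀ τ, ‖expMean a τ‖ ≤
      ‖∫ u : ℝ, K u * expMean a (τ + u / c)‖ + (2 / c * A + Real.exp (-τ) * B) := by
    intro c hc τ
    have hKh : Integrable (fun u => K u * expMean a (τ + u / c)) := by
      refine hK.norm.mono' ?_ (.of_forall fun u => ?_)
      · exact hK.aestronglyMeasurable.mul
          (measurable_expMean.comp (by fun_prop)).aestronglyMeasurable
      · rw [norm_mul]
        exact mul_le_of_le_one_right (norm_nonneg _) (norm_expMean_le_one ha _)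
    have h1 : expMean a τ = (∫ u : ℝ, K u * expMean a (τ + u / c)) +
        ∫ u : ℝ, K u * (expMean a τ - expMean a (τ + u / c)) := by
      simp_rw [mul_sub]
      rw [integral_sub (hK.mul_const _) hKh, integral_mul_const, hφ1]
      ring
    have h2 : ‖∫ u : ℝ, K u * (expMean a τ - expMean a (τ + u / c))‖ ≤
        2 / c * A + Real.exp (-τ) * B := by
      rw [← integral_const_mul, ← integral_const_mul, ← integral_add (hKn.const_mul _)
        (hK.norm.const_mul _)]
      refine norm_integral_le_of_norm_le ((hKn.const_mul _).add (hK.norm.const_mul _))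
        (.of_forall fun u => ?_)
      rw [norm_mul]
      have h3 := norm_expMean_sub_le ha τ (τ + u / c)
      rw [add_sub_cancel_left, abs_div, abs_of_pos hc] at h3
      calc _ ≤ ‖K u‖ * (2 * (|u| / c) + Real.exp (-τ)) := by gcongr
        _ = _ := by rw [Real.norm_eq_abs]; ring
    have h4 := norm_add_le (∫ u : ℝ, K u * expMean a (τ + u / c))
      (∫ u : ℝ, K u * (expMean a τ - expMean a (τ + u / c)))
    rw [← h1] at h4
    linarith
  have hA : 0 ≤ A := integral_nonneg fun u => by positivity
  rw [Metric.tendsto_nhds]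
  intro ε hε
  obtain ⟨c, hc, hcA⟩ : ∃ c : ℝ, 0 < c ∧ 2 / c * A < ε / 2 := by
    refine ⟨4 * (A + 1) / ε, by positivity, ?_⟩
    rw [div_mul_eq_mul_div, div_lt_iff₀ (by positivity)]
    field_simp
    nlinarith
  have hlim : Tendsto (fun τ => ‖∫ u : ℝ, K u * expMean a (τ + u / c)‖ +
      (2 / c * A + Real.exp (-τ) * B)) atTop (𝓝 (‖(0 : ℂ)‖ + (2 / c * A + 0 * B))) :=
    (tendsto_integral_fourier_mul_expMean ha hG hGa φ hφ hc).norm.add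
      (tendsto_const_nhds.add
        ((Real.tendsto_exp_atBot.comp tendsto_neg_atTop_atBot).mul_const _))
  have hlt : ‖(0 : ℂ)‖ + (2 / c * A + 0 * B) < ε := by simp; linarith
  filter_upwards [hlim.eventually_lt_const hlt] with τ hτ
  rw [dist_zero_right]
  exact (hbound hc τ).trans_lt hτ

theorem tendsto_mean_of_LSeries_continuousOn (ha : ∀ n, ‖a n‖ ≤ 1)
    (hG : ContinuousOn G {s | 1 ≤ s.re}) (hGa : ∀ s : ℂ, 1 < s.re → LSeries a s / s = G s) :
    Tendsto (fun N : ℕ => (1 / (N : ℂ)) * ∑ n ∈ Finset.Icc 1 N, a n) atTop (𝓝 0) := by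
  refine ((tendsto_expMean_atTop ha hG hGa).comp
    (Real.tendsto_log_atTop.comp tendsto_natCast_atTop_atTop)).congr' ?_
  filter_upwards [eventually_gt_atTop 0] with N hN
  have hN' : (0 : ℝ) < N := by exact_mod_cast hN
  simp [expMean, Real.exp_neg, Real.exp_log hN', mul_comm]

end Tauberian

/-- The Möbius function has mean value zero. -/
theorem tendsto_mean_moebius :
    Tendsto (fun N : ℕ => (1 / (N : ℂ)) *
      ∑ n ∈ Finset.Icc 1 N, ((ArithmeticFunction.moebius n : ℤ) : ℂ)) atTop (𝓝 0) := by
  -- `(s - 1) * ζ s` with the pole removed; the value at `1` is the residue. Then `1 / (s * ζ s) =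
  -- (s - 1) / (s * Z s)` is continuous up to `re s = 1`.
  set Z : ℂ → ℂ := Function.update (fun s => (s - 1) * riemannZeta s) 1 1 with hZ
  have hZc : Continuous Z := by
    rw [continuous_iff_continuousAt]
    intro s
    rcases eq_or_ne s 1 with rfl | hs
    · exact continuousAt_update_same.2 riemannZeta_residue_one
    · rw [hZ, continuousAt_update_of_ne hs]
      exact (continuousAt_id.sub continuousAt_const).mul
        (differentiableAt_riemannZeta hs).continuousAt
  have hZ0 : ∀ s : ℂ, 1 ≤ s.re → Z s ≠ 0 := by
    intro s hs
    rcases eq_or_ne s 1 with rfl | h1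
    · simp [hZ]
    · rw [hZ, Function.update_of_ne h1]
      exact mul_ne_zero (sub_ne_zero.2 h1) (riemannZeta_ne_zero_of_one_le_re hs)
  refine tendsto_mean_of_LSeries_continuousOn
    (a := fun n => ((ArithmeticFunction.moebius n : ℤ) : ℂ))
    (G := fun s => (s - 1) / (s * Z s)) ?_ ?_ ?_
  · intro n
    rw [Complex.norm_intCast]
    exact_mod_cast ArithmeticFunction.abs_moebius_le_one
  · refine ContinuousOn.div (by fun_prop) (by fun_prop) fun s (hs : 1 ≤ s.re) => ?_
    refine mul_ne_zero ?_ (hZ0 s hs)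
    rintro rfl
    norm_num at hs
  · intro s hs
    have h1 : s ≠ 1 := by rintro rfl; simp at hs
    have h0 : s ≠ 0 := by rintro rfl; norm_num at hs
    have hz := riemannZeta_ne_zero_of_one_lt_re hs
    have := LSeries_one_mul_Lseries_moebius hs
    rw [LSeries_one_eq_riemannZeta hs] at this
    rw [hZ, Function.update_of_ne h1, eq_div_of_mul_eq hz ((mul_comm _ _).trans this)]
    have := sub_ne_zero.2 h1
    field_simp

/-! ### The Kátai–Bourgain–Sarnak–Ziegler orthogonality criterion -/

section OrthogonalityCriterion

theorem card_filter_dvd_Icc (N d : ℕ) : ((Finset.Icc 1 N).filter (d ∣ ·)).card = N / d :=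
  Nat.Ioc_filter_dvd_card_eq_div N d

/-- The Turán–Kubilius inequality for the number of prime divisors in a finite set. -/
theorem sum_sq_card_filter_dvd_sub_le {P : Finset ℕ} (hP : ∀ p ∈ P, p.Prime) (N : ℕ) :
    ∑ n ∈ Finset.Icc 1 N, (((P.filter (· ∣ n)).card : ℝ) - ∑ p ∈ P, 1 / (p : ℝ)) ^ 2 ≤
      N * (∑ p ∈ P, 1 / (p : ℝ)) + 2 * (∑ p ∈ P, 1 / (p : ℝ)) * P.card := by
  set A := ∑ p ∈ P, 1 / (p : ℝ)
  have hA : 0 ≤ A := Finset.sum_nonneg fun p _ => by positivity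
  have hω : ∀ n, ((P.filter (· ∣ n)).card : ℝ) = ∑ p ∈ P, if p ∣ n then (1 : ℝ) else 0 :=
    fun n => by rw [Finset.sum_boole]
  have hcount : ∀ d, ∑ n ∈ Finset.Icc 1 N, (if d ∣ n then (1 : ℝ) else 0) = (N / d : ℕ) :=
    fun d => by rw [Finset.sum_boole, card_filter_dvd_Icc]
  -- Expand the square: the first moment loses at most `1` per prime to rounding. In the second
  -- moment, pairs `p ≠ q` give at most `N / (p * q)` by coprimality, and the diagonal adds `N * A`.
  -- The terms `N * A ^ 2` cancel.
  have h1 : N * A - P.card ≤ ∑ n ∈ Finset.Icc 1 N, ((P.filter (· ∣ n)).card : ℝ) := by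
    simp_rw [hω]
    rw [Finset.sum_comm, Finset.mul_sum, Finset.card_eq_sum_ones, Nat.cast_sum,
      ← Finset.sum_sub_distrib]
    refine Finset.sum_le_sum fun p hp => ?_
    rw [hcount, mul_one_div]
    have := Nat.lt_div_mul_add (a := N) (hP p hp).pos
    have hp0 : (0 : ℝ) < p := by exact_mod_cast (hP p hp).pos
    rw [sub_le_iff_le_add, div_le_iff₀ hp0]
    push_cast
    have : (N : ℝ) < (N / p : ℕ) * p + p := by exact_mod_cast this
    linarith
  have h2 : ∑ n ∈ Finset.Icc 1 N, ((P.filter (· ∣ n)).card : ℝ) ^ 2 ≤ N * A ^ 2 + N * A := by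
    have hle : ∀ p ∈ P, ∀ q ∈ P, ∑ n ∈ Finset.Icc 1 N,
        ((if p ∣ n then (1 : ℝ) else 0) * (if q ∣ n then (1 : ℝ) else 0)) ≤
          N * (1 / p * (1 / q)) + (if p = q then N * (1 / (p : ℝ)) else 0) := by
      intro p hp q hq
      by_cases hpq : p = q
      · subst hpq
        simp only [if_true]
        calc _ = ∑ n ∈ Finset.Icc 1 N, (if p ∣ n then (1 : ℝ) else 0) := by
              refine Finset.sum_congr rfl fun n _ => ?_
              split_ifs <;> simp
          _ ≤ N * (1 / (p : ℝ)) := by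
              rw [hcount, mul_one_div]; exact Nat.cast_div_le
          _ ≤ _ := by
              have : (0 : ℝ) ≤ N * (1 / p * (1 / p)) := by positivity
              linarith
      · rw [if_neg hpq, add_zero]
        have hco : Nat.Coprime p q := (Nat.coprime_primes (hP p hp) (hP q hq)).2 hpq
        calc _ = ∑ n ∈ Finset.Icc 1 N, (if p * q ∣ n then (1 : ℝ) else 0) := by
              refine Finset.sum_congr rfl fun n _ => ?_
              have : p * q ∣ n ↔ p ∣ n ∧ q ∣ n :=
                ⟨fun h => ⟨dvd_of_mul_right_dvd h, dvd_of_mul_left_dvd h⟩,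
                  fun h => hco.mul_dvd_of_dvd_of_dvd h.1 h.2⟩
              by_cases h1 : p ∣ n <;> by_cases h2 : q ∣ n <;> simp [this, h1, h2]
          _ ≤ _ := by
              rw [hcount, one_div_mul_one_div, mul_one_div]
              exact_mod_cast Nat.cast_div_le
    calc _ = ∑ p ∈ P, ∑ q ∈ P, ∑ n ∈ Finset.Icc 1 N,
        ((if p ∣ n then (1 : ℝ) else 0) * (if q ∣ n then (1 : ℝ) else 0)) := by
          simp_rw [hω, sq, Finset.sum_mul_sum]
          rw [Finset.sum_comm]
          refine Finset.sum_congr rfl fun p _ => Finset.sum_comm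
      _ ≤ ∑ p ∈ P, ∑ q ∈ P,
          (N * (1 / (p : ℝ) * (1 / q)) + (if p = q then N * (1 / (p : ℝ)) else 0)) :=
        Finset.sum_le_sum fun p hp => Finset.sum_le_sum fun q hq => hle p hp q hq
      _ = N * A ^ 2 + N * A := by
        simp_rw [Finset.sum_add_distrib]
        rw [sq, Finset.sum_mul_sum, Finset.mul_sum]
        simp_rw [Finset.mul_sum]
        congr 1
        rw [Finset.mul_sum]
        refine Finset.sum_congr rfl fun p hp => by simp [hp]
  have h3 : ∑ n ∈ Finset.Icc 1 N, (((P.filter (· ∣ n)).card : ℝ) - A) ^ 2 =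
      ∑ n ∈ Finset.Icc 1 N, ((P.filter (· ∣ n)).card : ℝ) ^ 2 -
        2 * A * ∑ n ∈ Finset.Icc 1 N, ((P.filter (· ∣ n)).card : ℝ) + N * A ^ 2 := by
    simp_rw [sub_sq]
    rw [Finset.sum_add_distrib, Finset.sum_sub_distrib, Finset.mul_sum]
    simp only [Finset.sum_const, Nat.card_Icc, nsmul_eq_mul, add_tsub_cancel_right]
    congr 2
    refine Finset.sum_congr rfl fun n _ => by ring
  rw [h3]
  nlinarith

variable {F : ℕ → ℂ} {u : ArithmeticFunction ℂ}

theorem Icc_div_eq_filter {N p Q : ℕ} (hp : 0 < p) (hQ : 0 < Q) (hpQ : Q ≤ p) :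
    Finset.Icc 1 (N / p) = (Finset.Icc 1 (N / Q)).filter (fun m => p * m ≤ N) := by
  ext m
  simp only [Finset.mem_Icc, Finset.mem_filter, Nat.le_div_iff_mul_le hp,
    Nat.le_div_iff_mul_le hQ, mul_comm m p]
  constructor
  · rintro ⟨h1, h2⟩
    exact ⟨⟨h1, by nlinarith⟩, h2⟩
  · rintro ⟨⟨h1, _⟩, h2⟩
    exact ⟨h1, h2⟩

/-- Cauchy–Schwarz over the variable `m` for bilinear sums `∑ b p v m F (p m)`. -/
theorem sq_norm_sum_bilinear_le {b v : ℕ → ℂ} (hb : ∀ n, ‖b n‖ ≤ 1) (hv : ∀ n, ‖v n‖ ≤ 1)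
    {B : Finset ℕ} {Q : ℕ} (hQ : 0 < Q) (hB : ∀ p ∈ B, Q ≤ p) (N : ℕ) :
    ‖∑ p ∈ B, b p * ∑ m ∈ Finset.Icc 1 (N / p), F (p * m) * v m‖ ^ 2 ≤
      (N / Q : ℕ) * ∑ p ∈ B, ∑ q ∈ B,
        ‖∑ m ∈ Finset.Icc 1 (min (N / p) (N / q)), F (p * m) * starRingEnd ℂ (F (q * m))‖ := by
  -- All `p ≥ Q`, so `m` runs over the common range `m ≤ N / Q`, with the condition `p * m ≤ N`
  -- moved into the coefficient.
  set V : ℕ → ℂ := fun m => ∑ p ∈ B, if p * m ≤ N then b p * F (p * m) else 0 with hV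
  have h1 : ∑ p ∈ B, b p * ∑ m ∈ Finset.Icc 1 (N / p), F (p * m) * v m =
      ∑ m ∈ Finset.Icc 1 (N / Q), V m * v m := by
    simp_rw [hV, Finset.sum_mul]
    rw [Finset.sum_comm]
    refine Finset.sum_congr rfl fun p hp => ?_
    rw [Icc_div_eq_filter (hQ.trans_le (hB p hp)) hQ (hB p hp), Finset.sum_filter, Finset.mul_sum]
    refine Finset.sum_congr rfl fun m _ => ?_
    split_ifs <;> ring
  have h2 : (∑ m ∈ Finset.Icc 1 (N / Q), ((‖V m‖ ^ 2 : ℝ) : ℂ)) = ∑ p ∈ B, ∑ q ∈ B,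
      b p * starRingEnd ℂ (b q) * ∑ m ∈ Finset.Icc 1 (min (N / p) (N / q)),
        F (p * m) * starRingEnd ℂ (F (q * m)) := by
    calc _ = ∑ m ∈ Finset.Icc 1 (N / Q), ∑ p ∈ B, ∑ q ∈ B,
          (if p * m ≤ N then b p * F (p * m) else 0) *
            starRingEnd ℂ (if q * m ≤ N then b q * F (q * m) else 0) := by
          refine Finset.sum_congr rfl fun m _ => ?_
          rw [Complex.ofReal_pow, ← Complex.mul_conj', hV, map_sum, Finset.sum_mul_sum]
      _ = _ := by
          rw [Finset.sum_comm]
          refine Finset.sum_congr rfl fun p hp => ?_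
          rw [Finset.sum_comm]
          refine Finset.sum_congr rfl fun q hq => ?_
          have hI : Finset.Icc 1 (min (N / p) (N / q)) =
              (Finset.Icc 1 (N / Q)).filter (fun m => p * m ≤ N ∧ q * m ≤ N) := by
            rw [Finset.filter_and,
              ← Icc_div_eq_filter (hQ.trans_le (hB p hp)) hQ (hB p hp),
              ← Icc_div_eq_filter (hQ.trans_le (hB q hq)) hQ (hB q hq)]
            ext m
            simp only [Finset.mem_Icc, Finset.mem_inter, le_min_iff]
            tauto
          rw [hI, Finset.sum_filter, Finset.mul_sum]
          refine Finset.sum_congr rfl fun m _ => ?_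
          by_cases h1 : p * m ≤ N <;> by_cases h2 : q * m ≤ N <;> simp [h1, h2]
          ring
  have h3 : ∑ m ∈ Finset.Icc 1 (N / Q), ‖V m‖ ^ 2 ≤ ∑ p ∈ B, ∑ q ∈ B,
      ‖∑ m ∈ Finset.Icc 1 (min (N / p) (N / q)), F (p * m) * starRingEnd ℂ (F (q * m))‖ := by
    have h0 : ∑ m ∈ Finset.Icc 1 (N / Q), ‖V m‖ ^ 2 =
        ‖∑ m ∈ Finset.Icc 1 (N / Q), ((‖V m‖ ^ 2 : ℝ) : ℂ)‖ := by
      rw [← Complex.ofReal_sum, Complex.norm_real, Real.norm_of_nonneg]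
      exact Finset.sum_nonneg fun _ _ => by positivity
    rw [h0, h2]
    refine norm_sum_le_of_le _ fun p _ => norm_sum_le_of_le _ fun q _ => ?_
    rw [norm_mul, norm_mul, RCLike.norm_conj]
    exact mul_le_of_le_one_left (norm_nonneg _) (mul_le_one₀ (hb p) (norm_nonneg _) (hb q))
  rw [h1]
  calc _ ≤ (∑ m ∈ Finset.Icc 1 (N / Q), ‖V m‖) ^ 2 := by
        gcongr
        refine norm_sum_le_of_le _ fun m _ => ?_
        rw [norm_mul]
        exact mul_le_of_le_one_right (norm_nonneg _) (hv m)
    _ ≤ (N / Q : ℕ) * ∑ m ∈ Finset.Icc 1 (N / Q), ‖V m‖ ^ 2 := by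
        simpa using sq_sum_le_card_mul_sum_sq (s := Finset.Icc 1 (N / Q)) (f := fun m => ‖V m‖)
    _ ≤ _ := by gcongr

/-- In a dyadic block `B.card / Q` is at most `1` and at most `2 * ∑ 1 / p`. The diagonal therefore
gives `1 / √Q`, summable over dyadic `Q`, and the off-diagonal terms give a small multiple of `∑ 1 /
p`. -/
theorem eventually_norm_sum_bilinear_le (hF : ∀ n, ‖F n‖ ≤ 1) {b v : ℕ → ℂ}
    (hb : ∀ n, ‖b n‖ ≤ 1) (hv : ∀ n, ‖v n‖ ≤ 1) {ε : ℝ} (hε : 0 ≤ ε)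
    {B : Finset ℕ} {Q : ℕ} (hQ : 0 < Q) (hB : B ⊆ Finset.Ico Q (2 * Q))
    (hcor : ∀ p ∈ B, ∀ q ∈ B, p ≠ q → ∀ᶠ M : ℕ in atTop,
      ‖∑ m ∈ Finset.Icc 1 M, F (p * m) * starRingEnd ℂ (F (q * m))‖ ≤ ε * M) :
    ∀ᶠ N : ℕ in atTop, ‖∑ p ∈ B, b p * ∑ m ∈ Finset.Icc 1 (N / p), F (p * m) * v m‖ ≤
      N * (1 / √Q + 2 * √ε * ∑ p ∈ B, 1 / (p : ℝ)) := by
  have hBQ : ∀ p ∈ B, Q ≤ p := fun p hp => (Finset.mem_Ico.1 (hB hp)).1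
  have hQ' : (0 : ℝ) < Q := by exact_mod_cast hQ
  have hcard : (B.card : ℝ) ≤ Q := by
    have := Finset.card_le_card hB
    rw [Nat.card_Ico] at this
    exact_mod_cast this.trans (by omega)
  have hA : (B.card : ℝ) / Q ≤ 2 * ∑ p ∈ B, 1 / (p : ℝ) := by
    rw [Finset.card_eq_sum_ones, Nat.cast_sum, Finset.sum_div, Finset.mul_sum]
    refine Finset.sum_le_sum fun p hp => ?_
    have h2 : (p : ℝ) ≤ 2 * Q := by exact_mod_cast (Finset.mem_Ico.1 (hB hp)).2.le
    have h1 : (0 : ℝ) < p := by exact_mod_cast hQ.trans_le (hBQ p hp)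
    rw [mul_one_div, div_le_div_iff₀ hQ' h1]
    simpa using h2
  have hev : ∀ᶠ N : ℕ in atTop, ∀ p ∈ B, ∀ q ∈ B, p ≠ q →
      ‖∑ m ∈ Finset.Icc 1 (min (N / p) (N / q)), F (p * m) * starRingEnd ℂ (F (q * m))‖ ≤
        ε * (min (N / p) (N / q) : ℕ) := by
    rw [Filter.eventually_all_finset]
    intro p hp
    rw [Filter.eventually_all_finset]
    intro q hq
    rw [Filter.eventually_imp_distrib_left]
    intro hpq
    obtain ⟨M, hM⟩ := eventually_atTop.1 (hcor p hp q hq hpq)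
    filter_upwards [(Nat.tendsto_div_const_atTop
      (hQ.trans_le (hBQ p hp)).ne').eventually_ge_atTop M, (Nat.tendsto_div_const_atTop
      (hQ.trans_le (hBQ q hq)).ne').eventually_ge_atTop M] with N h1 h2
    exact hM _ (le_min h1 h2)
  filter_upwards [hev] with N hN
  set x : ℝ := N / Q
  have hx0 : 0 ≤ x := by positivity
  have hx : ∀ p ∈ B, ((N / p : ℕ) : ℝ) ≤ x := by
    intro p hp
    refine Nat.cast_div_le.trans ?_
    have : (Q : ℝ) ≤ p := by exact_mod_cast hBQ p hp
    exact div_le_div_of_nonneg_left (by positivity) hQ' this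
  have hpair : ∀ p ∈ B, ∀ q ∈ B,
      ‖∑ m ∈ Finset.Icc 1 (min (N / p) (N / q)), F (p * m) * starRingEnd ℂ (F (q * m))‖ ≤
        (if p = q then x else 0) + ε * x := by
    intro p hp q hq
    by_cases hpq : p = q
    · subst hpq
      rw [if_pos rfl, min_self]
      have h1 : ‖∑ m ∈ Finset.Icc 1 (N / p), F (p * m) * starRingEnd ℂ (F (p * m))‖ ≤
          (N / p : ℕ) := by
        refine norm_sum_Icc_le (a := fun m => F (p * m) * starRingEnd ℂ (F (p * m)))
          (fun m => ?_) _
        rw [norm_mul, RCLike.norm_conj]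
        exact mul_le_one₀ (hF _) (norm_nonneg _) (hF _)
      have := hx p hp
      have : 0 ≤ ε * x := by positivity
      linarith
    · rw [if_neg hpq, zero_add]
      refine (hN p hp q hq hpq).trans ?_
      gcongr
      exact le_trans (by exact_mod_cast min_le_left _ _) (hx p hp)
  have hsq := sq_norm_sum_bilinear_le (F := F) hb hv hQ hBQ N
  have hsum : ∑ p ∈ B, ∑ q ∈ B,
      ‖∑ m ∈ Finset.Icc 1 (min (N / p) (N / q)), F (p * m) * starRingEnd ℂ (F (q * m))‖ ≤
        B.card * x + B.card * (B.card * (ε * x)) := by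
    calc _ ≤ ∑ p ∈ B, ∑ q ∈ B, ((if p = q then x else 0) + ε * x) :=
          Finset.sum_le_sum fun p hp => Finset.sum_le_sum fun q hq => hpair p hp q hq
      _ = _ := by
          simp_rw [Finset.sum_add_distrib]
          simp
  set A := ∑ p ∈ B, 1 / (p : ℝ)
  have hA0 : 0 ≤ A := Finset.sum_nonneg fun p _ => by positivity
  refine abs_le_of_sq_le_sq' ?_ (by positivity) |>.2
  refine hsq.trans ?_
  calc _ ≤ x * (B.card * x + B.card * (B.card * (ε * x))) := by
        gcongr
        exact Nat.cast_div_le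
    _ = N ^ 2 * ((B.card : ℝ) / Q * (1 / Q) + ε * (B.card / Q) ^ 2) := by
        simp only [x]; field_simp
    _ ≤ N ^ 2 * (1 * (1 / Q) + ε * (2 * A) ^ 2) := by
        gcongr
        rwa [div_le_one hQ']
    _ ≤ (N * (1 / √Q + 2 * √ε * A)) ^ 2 := by
        refine le_of_le_of_eq ?_ (mul_pow _ _ 2).symm
        gcongr
        have h1 : (1 / √(Q : ℝ)) ^ 2 = 1 / Q := by rw [div_pow, Real.sq_sqrt hQ'.le, one_pow]
        have h2 : √ε ^ 2 = ε := Real.sq_sqrt hε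
        have h3 : 0 ≤ 1 / √(Q : ℝ) * (√ε * A) := by positivity
        have h4 : (1 / √(Q : ℝ) + 2 * √ε * A) ^ 2 =
          (1 / √(Q : ℝ)) ^ 2 + √ε ^ 2 * (2 * A) ^ 2 + 4 * (1 / √(Q : ℝ) * (√ε * A)) := by ring
        rw [h4, h1, h2]
        linarith

/-- Replace `∑ 1 / p` by the number of divisors of `n` in `P` (Turán–Kubilius and Cauchy–Schwarz),
then write `n = p * m`. Multiplicativity fails only if `p ∣ m`, for at most `N / p ^ 2` values of
`m`, each costing at most `2`. -/
theorem norm_sum_mul_sub_le (hF : ∀ n, ‖F n‖ ≤ 1) (hu : u.IsMultiplicative)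
    (hu1 : ∀ n, ‖u n‖ ≤ 1) {P : Finset ℕ} (hP : ∀ p ∈ P, p.Prime) (N : ℕ) :
    ‖((∑ p ∈ P, 1 / (p : ℝ) : ℝ) : ℂ) * ∑ n ∈ Finset.Icc 1 N, F n * u n -
      ∑ p ∈ P, u p * ∑ m ∈ Finset.Icc 1 (N / p), F (p * m) * u m‖ ≤
      √(N * (N * (∑ p ∈ P, 1 / (p : ℝ)) + 2 * (∑ p ∈ P, 1 / (p : ℝ)) * P.card)) +
        2 * N * ∑ p ∈ P, 1 / (p : ℝ) ^ 2 := by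
  set A := ∑ p ∈ P, 1 / (p : ℝ)
  have hω : ∑ n ∈ Finset.Icc 1 N, ((P.filter (· ∣ n)).card : ℂ) * (F n * u n) =
      ∑ p ∈ P, ∑ m ∈ Finset.Icc 1 (N / p), F (p * m) * u (p * m) := by
    have h : ∀ n, ((P.filter (· ∣ n)).card : ℂ) * (F n * u n) =
        ∑ p ∈ P, if p ∣ n then F n * u n else 0 := fun n => by
      rw [← Finset.sum_filter, Finset.sum_const, nsmul_eq_mul]
    simp_rw [h]
    rw [Finset.sum_comm]
    refine Finset.sum_congr rfl fun p hp => ?_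
    have hp0 := (hP p hp).pos
    rw [← Finset.sum_filter]
    symm
    refine Finset.sum_bij (fun m _ => p * m) ?_ ?_ ?_ (fun _ _ => rfl)
    · intro m hm
      rw [Finset.mem_Icc, Nat.le_div_iff_mul_le hp0] at hm
      simp only [Finset.mem_filter, Finset.mem_Icc, dvd_mul_right, and_true]
      exact ⟨Nat.mul_pos hp0 hm.1, by linarith [mul_comm m p, hm.2]⟩
    · intro m _ m' _ h
      exact Nat.eq_of_mul_eq_mul_left hp0 h
    · intro n hn
      obtain ⟨hn, m, rfl⟩ := Finset.mem_filter.1 hn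
      rw [Finset.mem_Icc] at hn
      refine ⟨m, ?_, rfl⟩
      rw [Finset.mem_Icc, Nat.le_div_iff_mul_le hp0]
      exact ⟨Nat.pos_of_mul_pos_left hn.1, by linarith [mul_comm m p, hn.2]⟩
  have h1 : ‖(A : ℂ) * ∑ n ∈ Finset.Icc 1 N, F n * u n -
      ∑ n ∈ Finset.Icc 1 N, ((P.filter (· ∣ n)).card : ℂ) * (F n * u n)‖ ≤
      √(N * (N * A + 2 * A * P.card)) := by
    rw [Finset.mul_sum, ← Finset.sum_sub_distrib]
    calc _ ≤ ∑ n ∈ Finset.Icc 1 N, |((P.filter (· ∣ n)).card : ℝ) - A| := by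
          refine norm_sum_le_of_le _ fun n _ => ?_
          rw [← sub_mul, norm_mul, norm_mul, norm_sub_rev]
          have : ‖((P.filter (· ∣ n)).card : ℂ) - (A : ℂ)‖ =
              |((P.filter (· ∣ n)).card : ℝ) - A| := by
            rw [← Complex.ofReal_natCast, ← Complex.ofReal_sub, Complex.norm_real,
              Real.norm_eq_abs]
          rw [this]
          exact mul_le_of_le_one_right (abs_nonneg _) (mul_le_one₀ (hF n) (norm_nonneg _) (hu1 n))
      _ ≤ _ := by
          refine Real.le_sqrt_of_sq_le ?_
          refine (sq_sum_le_card_mul_sum_sq).trans ?_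
          simp only [sq_abs, Nat.card_Icc, add_tsub_cancel_right]
          gcongr
          exact sum_sq_card_filter_dvd_sub_le hP N
  have h2 : ‖∑ p ∈ P, ∑ m ∈ Finset.Icc 1 (N / p), F (p * m) * u (p * m) -
      ∑ p ∈ P, u p * ∑ m ∈ Finset.Icc 1 (N / p), F (p * m) * u m‖ ≤
      2 * N * ∑ p ∈ P, 1 / (p : ℝ) ^ 2 := by
    rw [← Finset.sum_sub_distrib, Finset.mul_sum]
    refine norm_sum_le_of_le _ fun p hp => ?_
    rw [Finset.mul_sum, ← Finset.sum_sub_distrib]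
    calc _ ≤ ∑ m ∈ Finset.Icc 1 (N / p), (if p ∣ m then (2 : ℝ) else 0) := by
          refine norm_sum_le_of_le _ fun m _ => ?_
          split_ifs with hpm
          · refine (norm_sub_le _ _).trans ?_
            rw [norm_mul, norm_mul, norm_mul]
            have h1 := mul_le_one₀ (hF (p * m)) (norm_nonneg _) (hu1 (p * m))
            have h2 := mul_le_one₀ (hu1 p) (by positivity)
              (mul_le_one₀ (hF (p * m)) (norm_nonneg _) (hu1 m))
            linarith
          · rw [hu.map_mul_of_coprime ((Nat.Prime.coprime_iff_not_dvd (hP p hp)).2 hpm)]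
            refine le_of_eq ?_
            rw [norm_eq_zero]
            ring
      _ = 2 * ((N / p / p : ℕ) : ℝ) := by
          rw [← Finset.sum_filter, Finset.sum_const, card_filter_dvd_Icc, nsmul_eq_mul, mul_comm]
      _ ≤ 2 * N * (1 / (p : ℝ) ^ 2) := by
          rw [Nat.div_div_eq_div_mul, mul_assoc]
          gcongr
          refine Nat.cast_div_le.trans (le_of_eq ?_)
          push_cast
          ring
  rw [hω] at h1
  refine le_trans ?_ (add_le_add h1 h2)
  exact norm_sub_le_norm_sub_add_norm_sub _ _ _

theorem sum_filter_prime_Ico_two_pow {M : Type*} [AddCommMonoid M] (X : ℕ → M) {J K : ℕ}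
    (h : J ≤ K) :
    ∑ p ∈ (Finset.Ico (2 ^ J) (2 ^ K)).filter Nat.Prime, X p =
      ∑ j ∈ Finset.Ico J K, ∑ p ∈ (Finset.Ico (2 ^ j) (2 ^ (j + 1))).filter Nat.Prime, X p := by
  induction K, h using Nat.le_induction with
  | base => simp
  | succ K hK ih =>
    rw [Finset.sum_Ico_succ_top hK, ← ih]
    simp_rw [Finset.sum_filter]
    exact (Finset.sum_Ico_consecutive _ (Nat.pow_le_pow_right two_pos hK)
      (Nat.pow_le_pow_right two_pos K.le_succ)).symm

theorem tendsto_sum_one_div_prime_Ico (J : ℕ) :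
    Tendsto (fun K => ∑ p ∈ (Finset.Ico (2 ^ J) (2 ^ K)).filter Nat.Prime, 1 / (p : ℝ))
      atTop atTop := by
  have h1 := (not_summable_iff_tendsto_nat_atTop_of_nonneg (f := {p | Nat.Prime p}.indicator
    fun n : ℕ => 1 / (n : ℝ)) (fun n => Set.indicator_nonneg (fun _ _ => by positivity) n)).1
    not_summable_one_div_on_primes
  have h2 := tendsto_atTop_add_const_right _
    (-∑ i ∈ Finset.range (2 ^ J), {p | Nat.Prime p}.indicator (fun n : ℕ => 1 / (n : ℝ)) i)
    (h1.comp (tendsto_pow_atTop_atTop_of_one_lt (one_lt_two (α := ℕ))))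
  refine h2.congr' ?_
  filter_upwards [eventually_ge_atTop J] with K hK
  rw [Function.comp_apply, ← sub_eq_add_neg,
    ← Finset.sum_Ico_eq_sub _ (Nat.pow_le_pow_right two_pos hK), Finset.sum_filter]
  refine Finset.sum_congr rfl fun p _ => ?_
  simp [Set.indicator_apply]

/-- **Kátai–Bourgain–Sarnak–Ziegler criterion.** -/
theorem tendsto_mean_mul_of_prime_correlations (hF : ∀ n, ‖F n‖ ≤ 1) (hu : u.IsMultiplicative)
    (hu1 : ∀ n, ‖u n‖ ≤ 1)
    (hcor : ∀ ε : ℝ, 0 < ε → ∃ P₀ : ℕ, ∀ p q : ℕ, p.Prime → q.Prime → p ≠ q → P₀ ≤ p → P₀ ≤ q →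
      ∀ᶠ M : ℕ in atTop,
        ‖∑ m ∈ Finset.Icc 1 M, F (p * m) * starRingEnd ℂ (F (q * m))‖ ≤ ε * M) :
    Tendsto (fun N : ℕ => (1 / (N : ℂ)) * ∑ n ∈ Finset.Icc 1 N, F n * u n) atTop (𝓝 0) := by
  rw [Metric.tendsto_nhds]
  intro δ hδ
  -- Chosen so that the term `2 * √ε = δ / 4`, which survives division by `A`, is below `δ`.
  set ε : ℝ := (δ / 8) ^ 2 with hε
  have hε0 : 0 < ε := by positivity
  have hsε : √ε = δ / 8 := Real.sqrt_sq (by positivity)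
  obtain ⟨P₀, hP₀⟩ := hcor ε hε0
  obtain ⟨J, hJ⟩ : ∃ J : ℕ, P₀ ≤ 2 ^ J := ⟨P₀, Nat.lt_two_pow_self.le⟩
  have hgeom : Summable fun j : ℕ => (1 / √(2 : ℝ)) ^ j := by
    refine summable_geometric_of_lt_one (by positivity) ?_
    rw [div_lt_one (by positivity)]
    exact Real.lt_sqrt_of_sq_lt (by norm_num)
  set C₁ := ∑' j : ℕ, (1 / √(2 : ℝ)) ^ j
  have hsqs : Summable fun n : ℕ => 1 / (n : ℝ) ^ 2 :=
    Real.summable_one_div_nat_pow.2 one_lt_two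
  set C₂ := ∑' n : ℕ, 1 / (n : ℝ) ^ 2
  have hlim : Tendsto (fun A : ℝ => √2 * (√A)⁻¹ + (2 * C₂ + C₁) * A⁻¹ + 2 * √ε) atTop
      (𝓝 (√2 * 0 + (2 * C₂ + C₁) * 0 + 2 * √ε)) :=
    (((tendsto_inv_atTop_zero.comp Real.tendsto_sqrt_atTop).const_mul _).add
      (tendsto_inv_atTop_zero.const_mul _)).add_const _
  have hlt : √2 * 0 + (2 * C₂ + C₁) * 0 + 2 * √ε < δ := by rw [hsε]; linarith
  -- Since `∑ 1 / p` over primes diverges, `A` can be made large enough to absorb the bounded and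
  -- `√A` errors; `P` is then fixed before `N → ∞`.
  obtain ⟨K, hKδ, hKA, hJK⟩ := (((tendsto_sum_one_div_prime_Ico J).eventually
    (hlim.eventually_lt_const hlt)).and (((tendsto_sum_one_div_prime_Ico J).eventually_gt_atTop
      0).and (eventually_ge_atTop J))).exists
  set P := (Finset.Ico (2 ^ J) (2 ^ K)).filter Nat.Prime with hPdef
  have hP : ∀ p ∈ P, p.Prime := fun p hp => (Finset.mem_filter.1 hp).2
  set A := ∑ p ∈ P, 1 / (p : ℝ) with hAdef
  have hblock : ∀ j ∈ Finset.Ico J K, ∀ᶠ N : ℕ in atTop,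
      ‖∑ p ∈ (Finset.Ico (2 ^ j) (2 ^ (j + 1))).filter Nat.Prime,
        u p * ∑ m ∈ Finset.Icc 1 (N / p), F (p * m) * u m‖ ≤
      N * (1 / √((2 ^ j : ℕ) : ℝ) +
        2 * √ε * ∑ p ∈ (Finset.Ico (2 ^ j) (2 ^ (j + 1))).filter Nat.Prime, 1 / (p : ℝ)) := by
    intro j hj
    refine eventually_norm_sum_bilinear_le hF hu1 hu1 hε0.le (by positivity) ?_ ?_
    · rw [← pow_succ']
      exact Finset.filter_subset _ _
    · have hle : ∀ p ∈ (Finset.Ico (2 ^ j) (2 ^ (j + 1))).filter Nat.Prime, P₀ ≤ p := by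
        intro p hp
        exact (hJ.trans (Nat.pow_le_pow_right two_pos (Finset.mem_Ico.1 hj).1)).trans
          (Finset.mem_Ico.1 (Finset.mem_filter.1 hp).1).1
      intro p hp q hq hpq
      exact hP₀ p q (Finset.mem_filter.1 hp).2 (Finset.mem_filter.1 hq).2 hpq (hle p hp) (hle q hq)
  filter_upwards [(Filter.eventually_all_finset _).2 hblock, eventually_ge_atTop (2 * P.card),
    eventually_gt_atTop 0] with N hN hNP hN0
  have hN0' : (0 : ℝ) < N := by exact_mod_cast hN0
  have hmain := norm_sum_mul_sub_le hF hu hu1 hP N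
  have h1 : ‖∑ p ∈ P, u p * ∑ m ∈ Finset.Icc 1 (N / p), F (p * m) * u m‖ ≤
      N * (C₁ + 2 * √ε * A) := by
    rw [hPdef, sum_filter_prime_Ico_two_pow _ hJK]
    refine (norm_sum_le_of_le _ hN).trans ?_
    rw [← Finset.mul_sum, Finset.sum_add_distrib, ← Finset.mul_sum,
      ← sum_filter_prime_Ico_two_pow _ hJK]
    gcongr
    refine le_trans (le_of_eq ?_) (hgeom.sum_le_tsum (Finset.Ico J K) fun j _ => by positivity)
    refine Finset.sum_congr rfl fun j _ => ?_
    have hpow : (2 : ℝ) ^ j = (√2 ^ j) ^ 2 := by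
      rw [← pow_mul, mul_comm, pow_mul, Real.sq_sqrt zero_le_two]
    rw [Nat.cast_pow, Nat.cast_ofNat, hpow, Real.sqrt_sq (by positivity), div_pow, one_pow]
  have h2 : √(N * (N * A + 2 * A * P.card)) ≤ N * (√2 * √A) := by
    rw [← Real.sqrt_mul (by norm_num)]
    refine Real.sqrt_le_iff.2 ⟨by positivity, ?_⟩
    rw [mul_pow, Real.sq_sqrt (by positivity)]
    have : (2 * P.card : ℝ) ≤ N := by exact_mod_cast hNP
    have : A * (2 * P.card) ≤ A * N := by gcongr
    nlinarith
  have h3 : ∑ p ∈ P, 1 / (p : ℝ) ^ 2 ≤ C₂ := hsqs.sum_le_tsum P fun j _ => by positivity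
  rw [dist_zero_right, norm_mul, norm_div, norm_one, Complex.norm_natCast]
  set S := ∑ n ∈ Finset.Icc 1 N, F n * u n
  have h4 : A * ‖S‖ ≤ N * (√2 * √A + (2 * C₂ + C₁) + 2 * √ε * A) := by
    have h5 := norm_le_norm_add_norm_sub' ((A : ℂ) * S)
      (∑ p ∈ P, u p * ∑ m ∈ Finset.Icc 1 (N / p), F (p * m) * u m)
    rw [norm_mul, Complex.norm_real, Real.norm_of_nonneg hKA.le] at h5
    have : 2 * N * ∑ p ∈ P, 1 / (p : ℝ) ^ 2 ≤ 2 * N * C₂ := by gcongr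
    linarith
  refine lt_of_le_of_lt ?_ hKδ
  have hsA : 0 < √A := Real.sqrt_pos.2 hKA
  have hAA : √A * √A = A := Real.mul_self_sqrt hKA.le
  rw [one_div, inv_mul_le_iff₀ hN0']
  refine le_of_mul_le_mul_left (h4.trans (le_of_eq ?_)) hKA
  have h6 : A * (√A)⁻¹ = √A := by
    rw [← hAA]; field_simp
    rw [Real.sqrt_sq (Real.sqrt_nonneg _)]
  have h7 : A * A⁻¹ = 1 := mul_inv_cancel₀ hKA.ne'
  linear_combination -(N * √2) * h6 - N * (2 * C₂ + C₁) * h7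

end OrthogonalityCriterion

/-! ### Invariant measures of continuous maps -/

section InvariantMeasures

variable {Z : Type*} [MetricSpace Z] [MeasurableSpace Z] [BorelSpace Z]
  {R : Z → Z}

theorem continuous_integral_probabilityMeasure (g : BoundedContinuousFunction Z ℝ) :
    Continuous fun ρ : ProbabilityMeasure Z => ∫ z, g z ∂(ρ : Measure Z) := by
  rw [continuous_iff_continuousAt]
  exact fun ρ => ProbabilityMeasure.tendsto_iff_forall_integral_tendsto.1 tendsto_id g

theorem measurePreserving_iff_forall_integral_comp_eq (hR : Continuous R)
    (ρ : Measure Z) [IsFiniteMeasure ρ] :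
    MeasurePreserving R ρ ρ ↔
      ∀ g : BoundedContinuousFunction Z ℝ, ∫ z, g (R z) ∂ρ = ∫ z, g z ∂ρ := by
  constructor
  · intro h g
    rw [← integral_map h.measurable.aemeasurable g.continuous.aestronglyMeasurable, h.map_eq]
  · intro h
    refine ⟨hR.measurable, ext_of_forall_integral_eq_of_IsFiniteMeasure fun g => ?_⟩
    rw [integral_map hR.measurable.aemeasurable g.continuous.aestronglyMeasurable, h]

theorem isClosed_setOf_measurePreserving (hR : Continuous R) :
    IsClosed {ρ : ProbabilityMeasure Z | MeasurePreserving R (ρ : Measure Z) ρ} := by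
  simp_rw [measurePreserving_iff_forall_integral_comp_eq hR, Set.ofPred_forall]
  refine isClosed_iInter fun g => isClosed_eq ?_ (continuous_integral_probabilityMeasure g)
  exact continuous_integral_probabilityMeasure (g.compContinuous ⟨R, hR⟩)

theorem eq_of_convexCombination_eq_of_le {a b x y M : ℝ} (ha : 0 < a) (hb : 0 < b)
    (hab : a + b = 1) (hx : x ≤ M) (hy : y ≤ M) (h : a * x + b * y = M) : x = M := by
  refine hx.eq_of_not_lt fun hlt => ?_
  have h1 := mul_lt_mul_of_pos_left hlt ha
  have h2 := mul_le_mul_of_nonneg_left hy hb.le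
  have h3 : a * M + b * M = M := by rw [← add_mul, hab, one_mul]
  linarith

variable [CompactSpace Z]

/-- The invariant measures maximising `∫ h` form a compact face of the set of all invariant ones. An
extreme point of this face is extreme among all invariant probability measures, hence ergodic. -/
theorem exists_ergodic_integral_le (hR : Continuous R) (ρ : ProbabilityMeasure Z)
    (hρ : MeasurePreserving R (ρ : Measure Z) ρ) (h : BoundedContinuousFunction Z ℝ) :
    ∃ ρ' : ProbabilityMeasure Z, Ergodic R (ρ' : Measure Z) ∧
      ∫ z, h z ∂(ρ : Measure Z) ≤ ∫ z, h z ∂(ρ' : Measure Z) := by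
  set I := {ρ : ProbabilityMeasure Z | MeasurePreserving R (ρ : Measure Z) ρ}
  have hI : IsClosed I := isClosed_setOf_measurePreserving hR
  obtain ⟨ρ₀, hρ₀, hmax⟩ := hI.isCompact.exists_isMaxOn ⟨ρ, hρ⟩
    (continuous_integral_probabilityMeasure h).continuousOn
  set face := I ∩ {m | ∫ z, h z ∂(m : Measure Z) = ∫ z, h z ∂(ρ₀ : Measure Z)}
  have hface : IsCompact face := (hI.inter
    (isClosed_eq (continuous_integral_probabilityMeasure h) continuous_const)).isCompact
  -- Extreme points are sought in a real vector space: a measure is encoded by its integrals against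
  -- all test functions, which determine it.
  let L : ProbabilityMeasure Z → BoundedContinuousFunction Z ℝ → ℝ :=
    fun m g => ∫ z, g z ∂(m : Measure Z)
  have hL : Continuous L := continuous_pi fun g => continuous_integral_probabilityMeasure g
  obtain ⟨_, ⟨ρ₁, hρ₁, rfl⟩, hext⟩ := (hface.image hL).extremePoints_nonempty
    (Set.Nonempty.image _ ⟨ρ₀, hρ₀, rfl⟩)
  refine ⟨ρ₁, Ergodic.of_mem_extremePoints ?_, ?_⟩
  · rw [mem_extremePoints_iff_left]
    refine ⟨⟨hρ₁.1, inferInstance⟩, ?_⟩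
    rintro m₁ ⟨hm₁, hm₁p⟩ m₂ ⟨hm₂, hm₂p⟩ ⟨a, b, ha, hb, hab, heq⟩
    have ha' : a ≠ ∞ := ne_top_of_le_ne_top ENNReal.one_ne_top (hab ▸ le_self_add)
    have hb' : b ≠ ∞ := ne_top_of_le_ne_top ENNReal.one_ne_top (hab ▸ le_add_self)
    have habr : a.toReal + b.toReal = 1 := by
      rw [← ENNReal.toReal_add ha' hb', hab, ENNReal.toReal_one]
    have har : 0 < a.toReal := ENNReal.toReal_pos ha.ne' ha'
    have hbr : 0 < b.toReal := ENNReal.toReal_pos hb.ne' hb'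
    have hint_eq : ∀ g : BoundedContinuousFunction Z ℝ, a.toReal * ∫ z, g z ∂m₁ +
        b.toReal * ∫ z, g z ∂m₂ = ∫ z, g z ∂(ρ₁ : Measure Z) := by
      intro g
      rw [← heq, integral_add_measure ((g.integrable m₁).smul_measure ha')
        ((g.integrable m₂).smul_measure hb'), integral_smul_measure, integral_smul_measure,
        smul_eq_mul, smul_eq_mul]
    let q₁ : ProbabilityMeasure Z := ⟨m₁, hm₁p⟩
    let q₂ : ProbabilityMeasure Z := ⟨m₂, hm₂p⟩
    have hle₁ : ∫ z, h z ∂m₁ ≤ ∫ z, h z ∂(ρ₀ : Measure Z) := hmax (a := q₁) hm₁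
    have hle₂ : ∫ z, h z ∂m₂ ≤ ∫ z, h z ∂(ρ₀ : Measure Z) := hmax (a := q₂) hm₂
    have hh := hint_eq h
    rw [hρ₁.2] at hh
    have hq₁ : q₁ ∈ face := ⟨hm₁, eq_of_convexCombination_eq_of_le har hbr habr hle₁ hle₂ hh⟩
    have hq₂ : q₂ ∈ face := ⟨hm₂, eq_of_convexCombination_eq_of_le hbr har
      (by rwa [add_comm]) hle₂ hle₁ (by rwa [add_comm])⟩
    have hLq := hext (Set.mem_image_of_mem L hq₁) (Set.mem_image_of_mem L hq₂)
      ⟨a.toReal, b.toReal, har, hbr, habr, funext hint_eq⟩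
    exact ext_of_forall_integral_eq_of_IsFiniteMeasure fun g => congrFun hLq g
  · rw [hρ₁.2]
    exact hmax (a := ρ) hρ

/-- Rotate `F` by a unit `c` making its integral nonnegative, and maximise the real part of `c * F`.
-/
theorem exists_ergodic_norm_integral_le (hR : Continuous R) (ρ : ProbabilityMeasure Z)
    (hρ : MeasurePreserving R (ρ : Measure Z) ρ) {F : Z → ℂ} (hF : Continuous F) :
    ∃ ρ' : ProbabilityMeasure Z, Ergodic R (ρ' : Measure Z) ∧
      ‖∫ z, F z ∂(ρ : Measure Z)‖ ≤ ‖∫ z, F z ∂(ρ' : Measure Z)‖ := by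
  have hint_eq : ∀ m : ProbabilityMeasure Z, Integrable F (m : Measure Z) := fun m =>
    (BoundedContinuousFunction.mkOfCompact ⟨F, hF⟩).integrable (m : Measure Z)
  obtain ⟨c, hc, hcF⟩ : ∃ c : ℂ, ‖c‖ = 1 ∧
      c * ∫ z, F z ∂(ρ : Measure Z) = ‖∫ z, F z ∂(ρ : Measure Z)‖ := by
    obtain ⟨c, hc, h⟩ := RCLike.exists_norm_eq_mul_self (∫ z, F z ∂(ρ : Measure Z))
    exact ⟨c, hc, h.symm⟩
  let h : BoundedContinuousFunction Z ℝ :=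
    BoundedContinuousFunction.mkOfCompact ⟨fun z => (c * F z).re, by fun_prop⟩
  have hh : ∀ m : ProbabilityMeasure Z,
      ∫ z, h z ∂(m : Measure Z) = (c * ∫ z, F z ∂(m : Measure Z)).re := by
    intro m
    rw [← integral_const_mul]
    exact integral_re ((hint_eq m).const_mul c)
  obtain ⟨ρ', hρ', hle⟩ := exists_ergodic_integral_le hR ρ hρ h
  refine ⟨ρ', hρ', ?_⟩
  rw [hh, hh, hcF, Complex.ofReal_re] at hle
  refine hle.trans ((Complex.re_le_norm _).trans ?_)
  rw [norm_mul, hc, one_mul]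

/-- The empirical measures of an orbit. -/
theorem exists_probabilityMeasure_integral_eq_mean (x : ℕ → Z) {N : ℕ} (hN : 0 < N) :
    ∃ ρ : ProbabilityMeasure Z, ∀ {E : Type} [NormedAddCommGroup E] [NormedSpace ℝ E]
      [CompleteSpace E] (g : Z → E), Continuous g →
        ∫ z, g z ∂(ρ : Measure Z) = (N : ℝ)⁻¹ • ∑ n ∈ Finset.Icc 1 N, g (x n) := by
  have hN0 : (N : ℝ≥0∞) ≠ 0 := by exact_mod_cast hN.ne'
  have hp : IsProbabilityMeasure
      ((N : ℝ≥0∞)⁻¹ • ∑ n ∈ Finset.Icc 1 N, Measure.dirac (x n)) := by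
    constructor
    simp [ENNReal.inv_mul_cancel hN0 (ENNReal.natCast_ne_top N)]
  refine ⟨⟨_, hp⟩, fun {E} _ _ _ g hg => ?_⟩
  change ∫ z, g z ∂((N : ℝ≥0∞)⁻¹ • ∑ n ∈ Finset.Icc 1 N, Measure.dirac (x n)) = _
  rw [integral_smul_measure, integral_finsetSum_measure]
  · simp
  · intro n _
    exact integrable_dirac (by simp)

/-- If all ergodic measures give `F` an integral of norm at most `ε`, then the Birkhoff averages of
`F` are eventually at most `ε + δ`. -/
theorem eventually_norm_sum_iterate_le (hR : Continuous R) {F : Z → ℂ} (hF : Continuous F) {ε : ℝ}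
    (hε : ∀ ρ : ProbabilityMeasure Z, Ergodic R (ρ : Measure Z) →
      ‖∫ z, F z ∂(ρ : Measure Z)‖ ≤ ε) (z₀ : Z) {δ : ℝ} (hδ : ε < δ) :
    ∀ᶠ N : ℕ in atTop, ‖∑ n ∈ Finset.Icc 1 N, F (R^[n] z₀)‖ ≤ δ * N := by
  by_contra hcon
  rw [not_eventually] at hcon
  set s : Set ℕ := {N | ¬ ‖∑ n ∈ Finset.Icc 1 N, F (R^[n] z₀)‖ ≤ δ * N}
  have : (atTop ⊓ 𝓟 s).NeBot := frequently_mem_iff_neBot.1 hcon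
  -- An ultrafilter concentrated on the bad `N` gives, by compactness, a limit of the empirical
  -- measures.
  set U := Ultrafilter.of (atTop ⊓ 𝓟 s)
  have hU : (U : Filter ℕ) ≤ atTop ⊓ 𝓟 s := Ultrafilter.of_le _
  have hU1 : (U : Filter ℕ) ≤ atTop := hU.trans inf_le_left
  have hUs : ∀ᶠ N in (U : Filter ℕ), N ∈ s := hU.trans inf_le_right (mem_principal_self s)
  have hUp : ∀ᶠ N in (U : Filter ℕ), 0 < N := hU1 (eventually_gt_atTop 0)
  have hex : ∀ N : ℕ, ∃ ρ : ProbabilityMeasure Z, 0 < N → ∀ {E : Type} [NormedAddCommGroup E]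
      [NormedSpace ℝ E] [CompleteSpace E] (g : Z → E), Continuous g →
        ∫ z, g z ∂(ρ : Measure Z) = (N : ℝ)⁻¹ • ∑ n ∈ Finset.Icc 1 N, g (R^[n] z₀) := by
    intro N
    rcases Nat.eq_zero_or_pos N with rfl | hN
    · exact ⟨⟨Measure.dirac z₀, inferInstance⟩, fun h => absurd h (lt_irrefl 0)⟩
    · obtain ⟨ρ, hρ⟩ := exists_probabilityMeasure_integral_eq_mean (fun n => R^[n] z₀) hN
      exact ⟨ρ, fun _ => hρ⟩
  choose m hm using hex
  obtain ⟨ρ, hρ⟩ : ∃ ρ, Tendsto m (U : Filter ℕ) (𝓝 ρ) := by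
    obtain ⟨ρ, -, hρ⟩ := isCompact_univ.ultrafilter_le_nhds (U.map m) (by simp)
    exact ⟨ρ, hρ⟩
  have hinv : MeasurePreserving R (ρ : Measure Z) ρ := by
    rw [measurePreserving_iff_forall_integral_comp_eq hR]
    intro g
    have h1 := ((continuous_integral_probabilityMeasure
      (g.compContinuous ⟨R, hR⟩)).tendsto ρ).comp hρ
    have h2 := ((continuous_integral_probabilityMeasure g).tendsto ρ).comp hρ
    have h3 : Tendsto (fun N : ℕ => (N : ℝ)⁻¹ * (2 * ‖g‖)) U (𝓝 0) := by
      simpa using (tendsto_inv_atTop_nhds_zero_nat (𝕜 := ℝ)).mono_left hU1 |>.mul_const (2 * ‖g‖)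
    refine sub_eq_zero.1 (tendsto_nhds_unique (h1.sub h2) (squeeze_zero_norm' ?_ h3))
    filter_upwards [hUp] with N hN
    have e1 := hm N hN (fun z => g (R z)) (g.continuous.comp hR)
    have e2 := hm N hN g g.continuous
    simp only [Function.comp, BoundedContinuousFunction.compContinuous_apply,
      ContinuousMap.coe_mk]
    rw [e1, e2, ← smul_sub, norm_smul, ← Finset.sum_sub_distrib]
    -- Telescoping: only two boundary terms remain, of size at most `2 * ‖g‖` before division by
    -- `N`.
    have e3 : ∑ n ∈ Finset.Icc 1 N, (g (R (R^[n] z₀)) - g (R^[n] z₀)) =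
        g (R^[N + 1] z₀) - g (R^[1] z₀) := by
      simp_rw [← Function.iterate_succ_apply' R]
      rw [← Finset.sum_Ico_sub (fun n => g (R^[n] z₀)) (by omega)]
      rfl
    rw [e3, norm_inv, Real.norm_natCast]
    gcongr
    refine (norm_sub_le _ _).trans ?_
    linarith [g.norm_coe_le_norm (R^[N + 1] z₀), g.norm_coe_le_norm (R^[1] z₀)]
  have hlim : Tendsto (fun N => ∫ z, F z ∂(m N : Measure Z)) U
      (𝓝 (∫ z, F z ∂(ρ : Measure Z))) :=
    (ProbabilityMeasure.tendsto_iff_forall_integral_rclike_tendsto ℂ).1 hρ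
      (BoundedContinuousFunction.mkOfCompact ⟨F, hF⟩)
  have hge : δ ≤ ‖∫ z, F z ∂(ρ : Measure Z)‖ := by
    refine ge_of_tendsto hlim.norm ?_
    filter_upwards [hUp, hUs] with N hN hNs
    have hN' : (0 : ℝ) < N := by exact_mod_cast hN
    rw [hm N hN F hF, norm_smul, norm_inv, Real.norm_natCast, le_inv_mul_iff₀ hN', mul_comm]
    exact (not_le.1 hNs).le
  obtain ⟨ρ', hρ', hle⟩ := exists_ergodic_norm_integral_le hR ρ hinv hF
  linarith [hε ρ' hρ']

end InvariantMeasures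

/-! ### Factors, powers and joinings -/

section Factors

theorem ae_semiconj_iterate {α β : Type*} [MeasurableSpace α] {μ : Measure α} {f : α → α}
    {g : β → β} {π : α → β} (hf : MeasurePreserving f μ μ)
    (h : ∀ᵐ x ∂μ, π (f x) = g (π x)) (n : ℕ) : ∀ᵐ x ∂μ, π (f^[n] x) = g^[n] (π x) := by
  induction n with
  | zero => simp
  | succ n ih =>
    filter_upwards [h, hf.quasiMeasurePreserving.ae ih] with x h1 h2
    rw [Function.iterate_succ_apply, h2, h1, Function.iterate_succ_apply]

variable {α β : Type*} [MeasurableSpace α] [MeasurableSpace β] {μ : Measure α} {ν : Measure β}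
  {f : α → α} {g : β → β} {π : α → β}

/-- A factor of an ergodic map is ergodic. -/
theorem Ergodic.of_ae_semiconj (hf : Ergodic f μ) (hπ : MeasurePreserving π μ ν)
    (hg : Measurable g) (h : ∀ᵐ x ∂μ, π (f x) = g (π x)) : Ergodic g ν := by
  have hmap : Measure.map g ν = ν := by
    rw [← hπ.map_eq, Measure.map_map hg hπ.measurable]
    calc _ = Measure.map (π ∘ f) μ :=
          Measure.map_congr (h.mono fun x hx => hx.symm)
      _ = Measure.map π μ := by
          rw [← Measure.map_map hπ.measurable hf.measurable, hf.map_eq]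
  refine ⟨⟨hg, hmap⟩, ⟨fun s hs hgs => ?_⟩⟩
  have hinv : f ⁻¹' (π ⁻¹' s) =ᵐ[μ] π ⁻¹' s := by
    filter_upwards [h] with x hx
    refine propext ?_
    change π (f x) ∈ s ↔ π x ∈ s
    rw [hx, ← Set.mem_preimage, hgs]
  have hc := hf.quasiErgodic.ae_empty_or_univ₀ (hπ.measurable hs).nullMeasurableSet hinv
  rw [eventuallyConst_set']
  rcases hc with hc | hc
  · left
    rw [ae_eq_empty] at hc ⊢
    rwa [← hπ.measure_preimage hs.nullMeasurableSet]
  · right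
    rw [ae_eq_univ] at hc ⊢
    rwa [← hπ.measure_preimage hs.compl.nullMeasurableSet]

/-- The inverse of an isomorphism of measure-preserving systems intertwines them as well. -/
theorem ae_semiconj_inverse {ψ : β → α} (hψ : MeasurePreserving ψ ν μ)
    (hf : MeasurePreserving f μ μ)
    (h : ∀ᵐ x ∂μ, π (f x) = g (π x)) (hψπ : ∀ᵐ x ∂μ, ψ (π x) = x)
    (hπψ : ∀ᵐ y ∂ν, π (ψ y) = y) : ∀ᵐ y ∂ν, ψ (g y) = f (ψ y) := by
  filter_upwards [hψ.quasiMeasurePreserving.ae h,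
    (hf.comp hψ).quasiMeasurePreserving.ae hψπ, hπψ] with y h1 h2 h3
  rw [h3] at h1
  rw [← h1]
  exact h2

end Factors

section UniqueErgodicity

variable {Y : Type*} [MeasurableSpace Y] {S : Y → Y} {ν : Measure Y}

/-- If `S` is uniquely ergodic and `S^[r]` is ergodic, then `S^[r]` is uniquely ergodic. -/
theorem IsUniquelyErgodic.eq_of_measurePreserving_iterate (hν : IsUniquelyErgodic S ν) {r : ℕ}
    (hr : 0 < r) (herg : Ergodic S^[r] ν) {ν' : Measure Y} [IsProbabilityMeasure ν']
    (hν' : MeasurePreserving S^[r] ν' ν') : ν' = ν := by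
  have := hν.1
  have hS : Measurable S := hν.2.1.measurable
  have hr0 : (r : ℝ≥0∞) ≠ 0 := by exact_mod_cast hr.ne'
  -- Averaging the images of `ν'` under `S^[i]`, `i < r`, gives an `S`-invariant measure, hence `ν`.
  set m : Measure Y := (r : ℝ≥0∞)⁻¹ • ∑ i ∈ Finset.range r, Measure.map S^[i] ν' with hm
  have hmap : Measure.map S m = m := by
    have h1 : Measure.map S (∑ i ∈ Finset.range r, Measure.map S^[i] ν') =
        ∑ i ∈ Finset.range r, Measure.map S^[i + 1] ν' := by
      rw [← Measure.mapₗ_apply_of_measurable hS, map_sum]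
      refine Finset.sum_congr rfl fun i _ => ?_
      rw [Measure.mapₗ_apply_of_measurable hS, Measure.map_map hS (hS.iterate i),
        Function.iterate_succ']
    rw [hm, Measure.map_smul, h1]
    congr 1
    obtain ⟨k, rfl⟩ := Nat.exists_eq_add_one_of_ne_zero hr.ne'
    rw [Finset.sum_range_succ, Finset.sum_range_succ', hν'.map_eq]
    simp
  have hmp : IsProbabilityMeasure m := by
    constructor
    have h1 : ∀ i ∈ Finset.range r, (Measure.map S^[i] ν') Set.univ = 1 := fun i _ =>
      (Measure.isProbabilityMeasure_map (hS.iterate i).aemeasurable).measure_univ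
    rw [hm, Measure.smul_apply, Measure.finsetSum_apply, Finset.sum_congr rfl h1]
    simp [ENNReal.inv_mul_cancel hr0 (ENNReal.natCast_ne_top r)]
  have hmν : m = ν := hν.2.2 m hmp ⟨hS, hmap⟩
  -- The term `i = 0` of the average shows `ν' ≪ ν`, and an ergodic measure admits no other
  -- invariant probability measure absolutely continuous with respect to it.
  refine herg.eq_of_absolutelyContinuous hν' (Measure.AbsolutelyContinuous.mk fun s hs h0 => ?_)
  rw [← hmν, hm, Measure.smul_apply, Measure.finsetSum_apply, smul_eq_mul, mul_eq_zero] at h0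
  rcases h0 with h0 | h0
  · simp at h0
  · have := (Finset.sum_eq_zero_iff.1 h0) 0 (Finset.mem_range.2 hr)
    simpa using this

end UniqueErgodicity

/-! ### AOP and correlations along orbits -/

section AOP

variable {X : Type*} [MeasurableSpace X] {μ : Measure X} {T : X → X}

theorem HasAOP.exists_forall_norm_integral_le (hAOP : HasAOP T μ) {f g : X → ℂ}
    (hf : MemLp f 2 μ) (hg : MemLp g 2 μ) (hf0 : ∫ x, f x ∂μ = 0) (hg0 : ∫ x, g x ∂μ = 0)
    {ε : ℝ} (hε : 0 < ε) :
    ∃ P₀ : ℕ, ∀ p q : ℕ, p.Prime → q.Prime → p ≠ q → P₀ ≤ p → P₀ ≤ q →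
      ∀ κ ∈ ergodicJoinings T^[p] T^[q] μ, ‖∫ z : X × X, f z.1 * g z.2 ∂κ‖ ≤ ε := by
  have h := (hAOP f g hf hg hf0 hg0).eventually_lt_const (ENNReal.ofReal_pos.2 hε)
  rw [differentPrimesAtTop, eventually_inf_principal, prod_atTop_atTop_eq,
    eventually_atTop] at h
  obtain ⟨⟨a, b⟩, hab⟩ := h
  refine ⟨max a b, fun p q hp hq hpq hap hbq κ hκ => ?_⟩
  have h1 := hab (p, q) ⟨(le_max_left a b).trans hap, (le_max_right a b).trans hbq⟩ ⟨hp, hq, hpq⟩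
  have h2 : ‖∫ z : X × X, f z.1 * g z.2 ∂κ‖ₑ ≤ ENNReal.ofReal ε :=
    (le_iSup₂ (f := fun κ (_ : κ ∈ ergodicJoinings T^[p] T^[q] μ) =>
      ‖∫ z : X × X, f z.1 * g z.2 ∂κ‖ₑ) κ hκ).trans h1.le
  rwa [← ofReal_norm, ENNReal.ofReal_le_ofReal_iff hε.le] at h2

variable {Y : Type*} [MetricSpace Y] [CompactSpace Y] [MeasurableSpace Y] [BorelSpace Y]
  {S : Y → Y} {ν : Measure Y}

/-- Orthogonality of large prime powers along orbits in a uniquely ergodic model. -/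
theorem eventually_norm_sum_prime_correlation_le (hTerg : IsTotallyErgodic T μ)
    (hAOP : HasAOP T μ) (hS : Continuous S) (hν : IsUniquelyErgodic S ν)
    (hiso : AreIsomorphic T μ S ν) (f : C(Y, ℂ)) (hf : ∫ y, f y ∂ν = 0) (y : Y)
    {ε : ℝ} (hε : 0 < ε) :
    ∃ P₀ : ℕ, ∀ p q : ℕ, p.Prime → q.Prime → p ≠ q → P₀ ≤ p → P₀ ≤ q → ∀ᶠ M : ℕ in atTop,
      ‖∑ m ∈ Finset.Icc 1 M, f (S^[p * m] y) * starRingEnd ℂ (f (S^[q * m] y))‖ ≤ ε * M := by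
  obtain ⟨φ, ⟨hφ, ψ, hψ, hψφ, hφψ⟩, hconj⟩ := hiso
  have := hν.1
  have hT : MeasurePreserving T μ μ := (hTerg 1 one_pos).toMeasurePreserving
  have hψS : ∀ᵐ y ∂ν, ψ (S y) = T (ψ y) := ae_semiconj_inverse hψ hT hconj hψφ hφψ
  have hSerg : ∀ r, 0 < r → Ergodic S^[r] ν := fun r hr =>
    (hTerg r hr).of_ae_semiconj hφ (hS.measurable.iterate r) (ae_semiconj_iterate hT hconj r)
  have hfν : MemLp f 2 ν :=
    MemLp.of_bound f.continuous.aestronglyMeasurable ‖f‖ (.of_forall f.norm_coe_le_norm)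
  have hF : MemLp (f ∘ φ) 2 μ := hfν.comp_measurePreserving hφ
  have hF0 : ∫ x, (f ∘ φ) x ∂μ = 0 := by
    rw [← hf, ← hφ.map_eq, integral_map hφ.measurable.aemeasurable
      f.continuous.aestronglyMeasurable]
    rfl
  have hG0 : ∫ x, starRingEnd ℂ ((f ∘ φ) x) ∂μ = 0 := by
    rw [integral_conj, hF0, map_zero]
  have hG : MemLp (fun x => starRingEnd ℂ ((f ∘ φ) x)) 2 μ := hF.star
  obtain ⟨P₀, hP₀⟩ := hAOP.exists_forall_norm_integral_le hF hG hF0 hG0 (half_pos hε)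
  refine ⟨P₀, fun p q hp hq hpq hpP hqP => ?_⟩
  have hR : Continuous (Prod.map S^[p] S^[q]) := (hS.iterate p).prodMap (hS.iterate q)
  have hcont : Continuous fun z : Y × Y => f z.1 * starRingEnd ℂ (f z.2) := by fun_prop
  -- The correlation is a Birkhoff sum of `S^[p] × S^[q]` from `(y, y)`; AOP is used with `ε / 2`
  -- because the bound must be strict.
  have key := eventually_norm_sum_iterate_le hR hcont (ε := ε / 2) ?_ (y, y) (half_lt_self hε)
  · simpa only [Prod.map_iterate, Prod.map_apply, ← Function.iterate_mul] using key
  intro ρ hρ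
  have hm : MeasurePreserving (Prod.map S^[p] S^[q]) (ρ : Measure (Y × Y)) ρ :=
    hρ.toMeasurePreserving
  have hfst : Measure.map Prod.fst (ρ : Measure (Y × Y)) = ν := by
    have := Measure.isProbabilityMeasure_map (μ := (ρ : Measure (Y × Y)))
      measurable_fst.aemeasurable
    refine hν.eq_of_measurePreserving_iterate hp.pos (hSerg p hp.pos) ⟨(hS.iterate p).measurable, ?_⟩
    conv_rhs => rw [← hm.map_eq]
    rw [Measure.map_map (hS.iterate p).measurable measurable_fst,
      Measure.map_map measurable_fst hm.measurable]
    rfl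
  have hsnd : Measure.map Prod.snd (ρ : Measure (Y × Y)) = ν := by
    have := Measure.isProbabilityMeasure_map (μ := (ρ : Measure (Y × Y)))
      measurable_snd.aemeasurable
    refine hν.eq_of_measurePreserving_iterate hq.pos (hSerg q hq.pos) ⟨(hS.iterate q).measurable, ?_⟩
    conv_rhs => rw [← hm.map_eq]
    rw [Measure.map_map (hS.iterate q).measurable measurable_snd,
      Measure.map_map measurable_snd hm.measurable]
    rfl
  have hfst' : MeasurePreserving Prod.fst (ρ : Measure (Y × Y)) ν := ⟨measurable_fst, hfst⟩
  have hsnd' : MeasurePreserving Prod.snd (ρ : Measure (Y × Y)) ν := ⟨measurable_snd, hsnd⟩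
  have hΨ : Measurable (Prod.map ψ ψ) := hψ.measurable.prodMap hψ.measurable
  have hTm := hT.measurable
  -- The map `ψ` intertwines only `ν`-almost everywhere; since both marginals of `ρ` are `ν`, this
  -- suffices `ρ`-almost everywhere in each coordinate.
  have hκ : Measure.map (Prod.map ψ ψ) (ρ : Measure (Y × Y)) ∈ ergodicJoinings T^[p] T^[q] μ := by
    refine ⟨?_, ?_, ?_⟩
    · rw [Measure.map_map measurable_fst hΨ, ← hψ.map_eq, ← hfst,
        Measure.map_map hψ.measurable measurable_fst]
      rfl
    · rw [Measure.map_map measurable_snd hΨ, ← hψ.map_eq, ← hsnd,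
        Measure.map_map hψ.measurable measurable_snd]
      rfl
    · refine hρ.of_ae_semiconj (π := Prod.map ψ ψ) ⟨hΨ, rfl⟩
        ((hTm.iterate p).prodMap (hTm.iterate q)) ?_
      filter_upwards [hfst'.quasiMeasurePreserving.ae (ae_semiconj_iterate hν.2.1 hψS p),
        hsnd'.quasiMeasurePreserving.ae (ae_semiconj_iterate hν.2.1 hψS q)] with z h1 h2
      exact Prod.ext h1 h2
  have hle := hP₀ p q hp hq hpq hpP hqP _ hκ
  rw [integral_map hΨ.aemeasurable] at hle
  · refine le_of_eq_of_le (congrArg norm (integral_congr_ae ?_)) hle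
    filter_upwards [hfst'.quasiMeasurePreserving.ae hφψ,
      hsnd'.quasiMeasurePreserving.ae hφψ] with z h1 h2
    simp only [Prod.map_fst, Prod.map_snd, Function.comp_apply]
    rw [h1, h2]
  · have h1 : Measurable (f ∘ φ) := f.continuous.measurable.comp hφ.measurable
    exact ((h1.comp measurable_fst).mul
      (Complex.continuous_conj.measurable.comp (h1.comp measurable_snd))).aestronglyMeasurable

end AOP

/-! ### Conclusion for multiplicative functions and for Möbius -/

theorem theorem2 {X : Type*} [MeasurableSpace X] [StandardBorelSpace X]
    (μ : Measure X) [IsProbabilityMeasure μ] (T : X → X)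
    (hT : IsAutomorphism T μ) (hTerg : IsTotallyErgodic T μ) (hAOP : HasAOP T μ)
    {Y : Type*} [MetricSpace Y] [CompactSpace Y] [MeasurableSpace Y] [BorelSpace Y]
    (S : Y → Y) (hS : Continuous S) (ν : Measure Y) (hν : IsUniquelyErgodic S ν)
    (hiso : AreIsomorphic T μ S ν) :
    (∀ u : ArithmeticFunction ℂ, u.IsMultiplicative → (∀ n, ‖u n‖ ≤ 1) →
      ∀ f : C(Y, ℂ), ∫ y, f y ∂ν = 0 → ∀ y : Y,
        Tendsto (fun N : ℕ => (1 / (N : ℂ)) * ∑ n ∈ Finset.Icc 1 N, f (S^[n] y) * u n)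
          atTop (𝓝 0)) ∧
    IsMoebiusDisjoint S := by
  have := hν.1
  have main : ∀ u : ArithmeticFunction ℂ, u.IsMultiplicative → (∀ n, ‖u n‖ ≤ 1) →
      ∀ f : C(Y, ℂ), ∫ y, f y ∂ν = 0 → ∀ y : Y,
        Tendsto (fun N : ℕ => (1 / (N : ℂ)) * ∑ n ∈ Finset.Icc 1 N, f (S^[n] y) * u n)
          atTop (𝓝 0) := by
    intro u hu hu1 f hf y
    -- The criterion needs a sequence bounded by `1`; the added `1` keeps the divisor nonzero when
    -- `f = 0`.
    set c : ℂ := ((‖f‖ + 1 : ℝ) : ℂ) with hc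
    have hcpos : 0 < ‖f‖ + 1 := by positivity
    have hc0 : c ≠ 0 := Complex.ofReal_ne_zero.2 hcpos.ne'
    have hg0 : ∫ y, (c⁻¹ • f) y ∂ν = 0 := by
      simp only [ContinuousMap.smul_apply, integral_smul, hf, smul_zero]
    have hg1 : ∀ n, ‖(c⁻¹ • f) (S^[n] y)‖ ≤ 1 := by
      intro n
      rw [ContinuousMap.smul_apply, norm_smul, norm_inv, hc, Complex.norm_real,
        Real.norm_of_nonneg hcpos.le, inv_mul_le_one₀ hcpos]
      linarith [f.norm_coe_le_norm (S^[n] y)]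
    have h := (tendsto_mean_mul_of_prime_correlations hg1 hu hu1 fun ε hε =>
      eventually_norm_sum_prime_correlation_le hTerg hAOP hS hν hiso (c⁻¹ • f) hg0 y hε).const_mul c
    rw [mul_zero] at h
    refine h.congr fun N => ?_
    rw [mul_left_comm, Finset.mul_sum]
    congr 1
    refine Finset.sum_congr rfl fun n _ => ?_
    rw [ContinuousMap.smul_apply, smul_eq_mul]
    field_simp
  refine ⟨main, fun f y => ?_⟩
  set c : ℂ := ∫ y, f y ∂ν with hc
  -- The centred part is covered by `main`, the constant `c` by `tendsto_mean_moebius`.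
  set g : C(Y, ℂ) := f - ContinuousMap.const Y c
  have hg0 : ∫ y, g y ∂ν = 0 := by
    have hfi : Integrable f ν := (BoundedContinuousFunction.mkOfCompact f).integrable ν
    simp only [g, ContinuousMap.sub_apply, ContinuousMap.const_apply]
    rw [integral_sub hfi (integrable_const c)]
    simp [← hc]
  have h1 := main (ArithmeticFunction.moebius : ArithmeticFunction ℂ)
    ArithmeticFunction.isMultiplicative_moebius.intCast (fun n => by
      rw [ArithmeticFunction.intCoe_apply, Complex.norm_intCast]
      exact_mod_cast ArithmeticFunction.abs_moebius_le_one) g hg0 y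
  have h2 := h1.add (tendsto_mean_moebius.const_mul c)
  rw [mul_zero, add_zero] at h2
  refine h2.congr fun N => ?_
  rw [mul_left_comm c, ← mul_add, Finset.mul_sum, ← Finset.sum_add_distrib]
  congr 1
  refine Finset.sum_congr rfl fun n _ => ?_
  simp only [g, ContinuousMap.sub_apply, ContinuousMap.const_apply,
    ArithmeticFunction.intCoe_apply]
  ring
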